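/- Let $s \ge 2$, let $d_1,\dots,d_s$ be integers with every $d_i > 1$, and put $d=\prod_{i=1}^s d_i$. For a prime $p$ let $h=\sum_{i=1}^s x_i^{d_i}$ in $A=(\mathbb{Z}/p)[x_1,\dots,x_s]$, and for $n\ge 0$ let $e_n(h)$ be the length of $A/(h,x_1^{q},\dots,x_s^{q})$, where $q=p^n$. The lengths $e_n(h)$ are finite, and there is a unique real number $\mu=\mu_p>0$, the Hilbert-Kunz multiplicity of $h$, such that $e_n(h)=\mu q^{s-1}+O(q^{s-2})$ as $n\to\infty$ with $p$ fixed. For $\lambda\in\mathbb{Z}$ let $$C_\lambda=\sum_{\epsilon}(\epsilon_1\cdots\epsilon_s)\left(\frac{\epsilon_1}{d_1}+\cdots+\frac{\epsilon_s}{d_s}-2\lambda\right)^{s-1},$$ where the sum extends over the $\epsilon\in\{-1,1\}^s$ with $\frac{\epsilon_1}{d_1}+\cdots+\frac{\epsilon_s}{d_s}>2\lambda$. Then $C_\lambda=0$ for all but finitely many $\lambda\in\mathbb{Z}$, and as $p\to\infty$ through the primes, $$\mu_p\;\longrightarrow\;\frac{d\,2^{1-s}}{(s-1)!}\sum_{\lambda\in\mathbb{Z}}C_\lambda=\frac{d\,2^{1-s}}{(s-1)!}\Bigl(C_0+2\sum_{\lambda>0}C_\lambda\Bigr).$$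 -/

import Mathlib

/-- The element `∑ x_i ^ d_i` of `(ℤ/p)[x_1, …, x_s]`. -/
noncomputable def diagonalForm (p : ℕ) {s : ℕ} (d : Fin s → ℕ) : MvPolynomial (Fin s) (ZMod p) :=
  ∑ i, MvPolynomial.X i ^ d i

/-- The colength `e_n(f)`: the length of `A / (f, x_1 ^ q, …, x_s ^ q)`, where
`A = (ℤ/p)[x_1, …, x_s]` and `q = p ^ n`. -/
noncomputable def hkColength {p s : ℕ} (f : MvPolynomial (Fin s) (ZMod p)) (n : ℕ) : ℕ∞ :=
  Module.length (MvPolynomial (Fin s) (ZMod p))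
    (MvPolynomial (Fin s) (ZMod p) ⧸
      Ideal.span (insert f (Set.range fun i : Fin s => MvPolynomial.X i ^ (p ^ n))))

/-- `μ` is the Hilbert-Kunz multiplicity of `f`: it is positive, all the colengths `e_n` are finite,
and `e_n = μ q ^ (s - 1) + O(q ^ (s - 2))` with `q = p ^ n`, as `n → ∞`. (For `s ≥ 2`.) -/
def IsHilbertKunzMultiplicity {p s : ℕ} (f : MvPolynomial (Fin s) (ZMod p)) (μ : ℝ) : Prop :=
  0 < μ ∧ ∃ e : ℕ → ℕ, (∀ n, hkColength f n = (e n : ℕ∞)) ∧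
    Asymptotics.IsBigO Filter.atTop
      (fun n : ℕ => (e n : ℝ) - μ * ((p : ℝ) ^ n) ^ (s - 1))
      (fun n : ℕ => ((p : ℝ) ^ n) ^ (s - 2))

/-- `C_l = ∑ (ε_1 ⋯ ε_s) (ε_1 / d_1 + ⋯ + ε_s / d_s - 2 l) ^ (s - 1)`, over the sign vectors `ε` with
`ε_1 / d_1 + ⋯ + ε_s / d_s > 2 l`. -/
noncomputable def signSum {s : ℕ} (d : Fin s → ℕ) (l : ℤ) : ℝ :=
  ∑ ε : Fin s → ℤˣ with 2 * (l : ℝ) < ∑ i, ((ε i : ℤ) : ℝ) / (d i : ℝ),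
    (∏ i, ((ε i : ℤ) : ℝ)) * ((∑ i, ((ε i : ℤ) : ℝ) / (d i : ℝ)) - 2 * (l : ℝ)) ^ (s - 1)

/-! By Macaulay duality, linear functionals on `A / (h, x_i ^ q)` are functions on `ℕ ^ s` supported
in the cube `[0, q) ^ s` and killed by `∑ S_i ^ d_i`, with `S_i` the coordinate shifts. That
operator preserves residue classes modulo the `d_i` and acts on each of them as `T = ∑ S_i`. So
`e_n(h)` is a sum of `d` colengths `L(a)` of ideals `(x_i ^ a_i, ∑ x_i)`, every `a_i` being `⌊q /
d_i⌋` or one more (`exists_dual_quotient_equiv`, `finrank_box_inf_ker_diagonal`). A unit change of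
one `a_i` changes `L` by at most `q ^ (s - 2)` (`linColength_mono_lipschitz`), so `e_n = d L(⌊q /
d_i⌋) + O(q ^ (s - 2))`.

In characteristic `p`, `T ^ p = ∑ S_i ^ p`, whence `L(p a) = p ^ (s - 1) L(a)`
(`linColength_char_mul`). Hence `L(⌊q / d_i⌋) / q ^ (s - 1)` is Cauchy with steps `O(p ^ (-n))`, the
constant being independent of `p`. Its limit gives `μ_p`, and the term `n = 1` already gives `μ_p`
up to `O(1 / p)`. Only `L(a)` with all `a_i ≤ p` remains to be computed.

There `L(a)` counts the Jordan blocks of the tensor product of nilpotent blocks `J_{a_i}`. The rule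
`J_2 ⊗ J_c = J_{c+1} ⊕ J_{c-1}` for `p ∤ c`, with the value at `a_i = p`, determines `L`; the number
of box points whose coordinate sum is congruent modulo `p` to the middle value obeys the same
recursion (`linColength_eq_middleCount`). That number is a sum over `λ` of coefficients of `∏ (1 - X
^ a_i) / (1 - X) ^ s` in degrees spaced by `p`. Expanding over sign vectors and letting `p → ∞`
turns the binomial coefficients into the powers in `C_λ` (`tendsto_middleCount`). -/

namespace DiagonalHK

open Module

/-! ### Shift operators on functions on `ℕ ^ s` -/

section Operators

variable (k : Type*) [Field k] {s : ℕ}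

/-- The shift in the `i`-th coordinate on `k`-valued functions on `ℕ ^ s`. -/
def shift (i : Fin s) : Module.End k ((Fin s → ℕ) → k) :=
  LinearMap.funLeft k k fun j => j + Pi.single i 1

/-- The sum of the coordinate shifts. -/
def totalShift (s : ℕ) : Module.End k ((Fin s → ℕ) → k) := ∑ i, shift k i

/-- The functions on `ℕ ^ s` supported in the box `∏ [0, a i)`. -/
def box (a : Fin s → ℕ) : Submodule k ((Fin s → ℕ) → k) where
  carrier := {f | ∀ j i, a i ≤ j i → f j = 0}
  add_mem' hf hg j i h := by simp [hf j i h, hg j i h]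
  zero_mem' _ _ _ := rfl
  smul_mem' c f hf j i h := by simp [hf j i h]

/-- The functions supported in the box `a` killed by the `c`-th power of the total shift. -/
def boxKer (a : Fin s → ℕ) (c : ℕ) : Submodule k ((Fin s → ℕ) → k) :=
  box k a ⊓ LinearMap.ker (totalShift k s ^ c)

/-- The dimension of the space of functions supported in the box `a` killed by the total shift. By
duality this is the colength of the ideal generated by the `X i ^ a i` and `∑ X i`. -/
noncomputable def linColength (a : Fin s → ℕ) : ℕ := finrank k (boxKer k a 1)

variable {k}

theorem shift_apply (i : Fin s) (f : (Fin s → ℕ) → k) (j : Fin s → ℕ) :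
    shift k i f j = f (j + Pi.single i 1) := rfl

theorem shift_pow_apply (i : Fin s) (n : ℕ) (f : (Fin s → ℕ) → k) (j : Fin s → ℕ) :
    (shift k i ^ n) f j = f (j + Pi.single i n) := by
  induction n generalizing f with
  | zero => simp
  | succ n ih =>
    rw [pow_succ, Module.End.mul_apply, ih, shift_apply, add_assoc, ← Pi.single_add]

theorem shift_commute (i i' : Fin s) : Commute (shift k i) (shift k i') := by
  ext f j
  simp [Module.End.mul_apply, shift_apply, add_right_comm]

theorem totalShift_apply (f : (Fin s → ℕ) → k) (j : Fin s → ℕ) :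
    totalShift k s f j = ∑ i, f (j + Pi.single i 1) := by
  simp [totalShift, shift_apply]

theorem mem_box {a : Fin s → ℕ} {f : (Fin s → ℕ) → k} :
    f ∈ box k a ↔ ∀ j i, a i ≤ j i → f j = 0 := Iff.rfl

theorem mem_boxKer {a : Fin s → ℕ} {c : ℕ} {f : (Fin s → ℕ) → k} :
    f ∈ boxKer k a c ↔ f ∈ box k a ∧ (totalShift k s ^ c) f = 0 := Iff.rfl

theorem totalShift_mem_box {a : Fin s → ℕ} {f : (Fin s → ℕ) → k} (hf : f ∈ box k a) :
    totalShift k s f ∈ box k a := by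
  intro j i h
  rw [totalShift_apply]
  exact Finset.sum_eq_zero fun i' _ => hf _ i (h.trans (by simp))

theorem totalShift_pow_mem_box {a : Fin s → ℕ} {f : (Fin s → ℕ) → k} (hf : f ∈ box k a) (n : ℕ) :
    (totalShift k s ^ n) f ∈ box k a := by
  induction n with
  | zero => simpa
  | succ n ih => rw [pow_succ', Module.End.mul_apply]; exact totalShift_mem_box ih

/-- Functions supported in a box are the functions on that box. -/
def boxEquiv (a : Fin s → ℕ) : box k a ≃ₗ[k] ((∀ i, Fin (a i)) → k) where
  toFun f x := f.1 fun i => x i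
  map_add' _ _ := rfl
  map_smul' _ _ := rfl
  invFun g := ⟨fun j => if h : ∀ i, j i < a i then g fun i => ⟨j i, h i⟩ else 0, fun j i h => by
    exact dif_neg fun h' => absurd (h' i) (not_lt.2 h)⟩
  left_inv f := by
    ext j
    by_cases h : ∀ i, j i < a i
    · simp [h]
    · simp only [h, dite_false]
      push Not at h
      obtain ⟨i, hi⟩ := h
      exact (f.2 j i hi).symm
  right_inv g := by ext x; simp

instance (a : Fin s → ℕ) : FiniteDimensional k (box k a) :=
  Module.Finite.equiv (boxEquiv a).symm

instance (a : Fin s → ℕ) (c : ℕ) : FiniteDimensional k (boxKer k a c) :=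
  Submodule.finiteDimensional_of_le (inf_le_left : boxKer k a c ≤ box k a)

theorem finrank_box (a : Fin s → ℕ) : finrank k (box k a) = ∏ i, a i := by
  rw [(boxEquiv a).finrank_eq, finrank_fintype_fun_eq_card]
  simp

theorem finrank_boxKer_le (a : Fin s → ℕ) (c : ℕ) : finrank k (boxKer k a c) ≤ ∏ i, a i := by
  rw [← finrank_box (k := k)]
  exact Submodule.finrank_mono inf_le_left

theorem boxKer_zero (a : Fin s → ℕ) : boxKer k a 0 = ⊥ := by
  ext f; simp +contextual [mem_boxKer, mem_box]

theorem boxKer_mono (a : Fin s → ℕ) {c c' : ℕ} (h : c ≤ c') : boxKer k a c ≤ boxKer k a c' := by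
  intro f hf
  obtain ⟨e, rfl⟩ := Nat.exists_eq_add_of_le' h
  rw [mem_boxKer] at hf ⊢
  refine ⟨hf.1, ?_⟩
  rw [pow_add, Module.End.mul_apply, hf.2, map_zero]

/-- With `T` the total shift, `T ^ c` maps `ker T ^ (c + 1)` into `ker T`, with kernel `ker T ^ c`.
-/
theorem finrank_boxKer_succ_le (a : Fin s → ℕ) (c : ℕ) :
    finrank k (boxKer k a (c + 1)) ≤ finrank k (boxKer k a c) + linColength k a := by
  let L : boxKer k a (c + 1) →ₗ[k] boxKer k a 1 :=
    (totalShift k s ^ c).restrict fun f hf =>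
      mem_boxKer.2 ⟨totalShift_pow_mem_box hf.1 c, by
        rw [← Module.End.mul_apply, ← pow_add, add_comm 1 c, (mem_boxKer.1 hf).2]⟩
  have h1 := L.finrank_range_add_finrank_ker
  have h2 : finrank k (LinearMap.range L) ≤ linColength k a := Submodule.finrank_le _
  have h3 : finrank k (LinearMap.ker L) ≤ finrank k (boxKer k a c) := by
    let L' : LinearMap.ker L →ₗ[k] boxKer k a c :=
      ((boxKer k a (c + 1)).subtype ∘ₗ (LinearMap.ker L).subtype).codRestrict _ fun x =>
        mem_boxKer.2 ⟨x.1.2.1, congrArg Subtype.val (LinearMap.mem_ker.1 x.2)⟩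
    apply LinearMap.finrank_le_finrank_of_injective (f := L')
    intro x y h
    exact Subtype.ext (Subtype.ext (congrArg (fun z : boxKer k a c => z.1) h))
  omega

theorem finrank_boxKer_add_le (a : Fin s → ℕ) (c e : ℕ) :
    finrank k (boxKer k a (c + e)) ≤ finrank k (boxKer k a c) + e * linColength k a := by
  induction e with
  | zero => simp
  | succ e ih =>
    have := finrank_boxKer_succ_le (k := k) a (c + e)
    rw [← add_assoc, add_mul, one_mul]
    omega

/-- A function vanishing in degrees `≥ m` is killed by the `m`-th power of the total shift. -/
theorem totalShift_pow_eq_zero (m : ℕ) (f : (Fin s → ℕ) → k)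
    (hf : ∀ j, m ≤ ∑ i, j i → f j = 0) : (totalShift k s ^ m) f = 0 := by
  induction m generalizing f with
  | zero => ext j; simpa using hf j
  | succ m ih =>
    rw [pow_succ, Module.End.mul_apply]
    refine ih _ fun j hj => ?_
    rw [totalShift_apply]
    refine Finset.sum_eq_zero fun i _ => hf _ ?_
    simpa [Finset.sum_add_distrib] using hj

/-- A point of degree at least `∑ a i` lies outside the box, so the total shift is nilpotent there
of order at most `∑ a i`, and its kernel cannot be too small. This makes the multiplicity positive.
-/
theorem prod_le_sum_mul_linColength [NeZero s] (a : Fin s → ℕ) :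
    ∏ i, a i ≤ (∑ i, a i) * linColength k a := by
  have h : boxKer k a (∑ i, a i) = box k a := by
    refine inf_eq_left.2 fun f hf => totalShift_pow_eq_zero _ f fun j hj => ?_
    obtain ⟨i, -, hi⟩ := Finset.exists_le_of_sum_le Finset.univ_nonempty hj
    exact hf j i hi
  have h' := finrank_boxKer_add_le (k := k) a 0 (∑ i, a i)
  rw [boxKer_zero, zero_add, h, finrank_box, finrank_bot, zero_add] at h'
  exact h'

/-- Restriction of a function on `ℕ ^ (s + 1)` to the slice where the first coordinate is `n`. -/
def slice (n : ℕ) : ((Fin (s + 1) → ℕ) → k) →ₗ[k] ((Fin s → ℕ) → k) :=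
  LinearMap.funLeft k k fun j => Fin.cons n j

theorem slice_apply (n : ℕ) (f : (Fin (s + 1) → ℕ) → k) (j : Fin s → ℕ) :
    slice n f j = f (Fin.cons n j) := rfl

theorem slice_ext {f g : (Fin (s + 1) → ℕ) → k} (h : ∀ n, slice n f = slice n g) : f = g := by
  ext j
  rw [← Fin.cons_self_tail j]
  exact congrFun (h (j 0)) (Fin.tail j)

theorem slice_totalShift (n : ℕ) (f : (Fin (s + 1) → ℕ) → k) :
    slice n (totalShift k (s + 1) f) = totalShift k s (slice n f) + slice (n + 1) f := by
  ext j
  rw [Pi.add_apply, slice_apply, totalShift_apply, totalShift_apply, Fin.sum_univ_succ, add_comm]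
  congr 1
  · refine Finset.sum_congr rfl fun i _ => ?_
    rw [slice_apply]
    congr 1
    ext x
    refine Fin.cases ?_ (fun x => ?_) x
    · simp
    · simp [Pi.single_apply]
  · rw [slice_apply]
    congr 1
    ext x
    refine Fin.cases ?_ (fun x => ?_) x <;> simp

theorem mem_box_cons {a : Fin s → ℕ} {c : ℕ} {f : (Fin (s + 1) → ℕ) → k} :
    f ∈ box k (Fin.cons c a) ↔ (∀ n, slice n f ∈ box k a) ∧ ∀ n, c ≤ n → slice n f = 0 := by
  constructor
  · refine fun h => ⟨fun n j i hi => h _ i.succ (by simpa), fun n hn => ?_⟩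
    ext j
    exact h _ 0 (by simpa)
  · rintro ⟨h1, h2⟩ j i hi
    rw [← Fin.cons_self_tail j]
    change slice (j 0) f (Fin.tail j) = 0
    revert hi
    refine Fin.cases (fun hi => ?_) (fun i hi => ?_) i
    · rw [h2 _ (by simpa using hi)]; rfl
    · exact h1 _ _ i (by simpa [Fin.tail] using hi)

theorem slice_of_totalShift_eq_zero {f : (Fin (s + 1) → ℕ) → k}
    (hf : totalShift k (s + 1) f = 0) (n : ℕ) :
    slice n f = (-1 : k) ^ n • (totalShift k s ^ n) (slice 0 f) := by
  induction n with
  | zero => simp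
  | succ n ih =>
    have h := slice_totalShift n f
    rw [hf, map_zero, eq_comm, add_comm, add_eq_zero_iff_eq_neg] at h
    rw [h, ih, map_smul, pow_succ', pow_succ' (totalShift k s), Module.End.mul_apply]
    simp

/-- The slices of a kernel element satisfy `f_(n+1) = -T f_n`, so `f_0` determines it, and vanishing
of the slices from `c` on means `T ^ c f_0 = 0`. A variable is traded for a power of `T`. -/
theorem linColength_cons (c : ℕ) (a : Fin s → ℕ) :
    linColength k (Fin.cons c a : Fin (s + 1) → ℕ) = finrank k (boxKer k a c) := by
  let L : boxKer k (Fin.cons c a : Fin (s + 1) → ℕ) 1 →ₗ[k] boxKer k a c :=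
    ((slice 0).domRestrict _).codRestrict _ fun f => by
      have hf := mem_boxKer.1 f.2
      rw [pow_one] at hf
      have hb := mem_box_cons.1 hf.1
      refine mem_boxKer.2 ⟨hb.1 0, ?_⟩
      have h := (slice_of_totalShift_eq_zero hf.2 c).symm.trans (hb.2 c le_rfl)
      exact (smul_eq_zero_iff_right (pow_ne_zero c (neg_ne_zero.2 one_ne_zero))).1 h
  refine (LinearEquiv.ofBijective L ⟨?_, ?_⟩).finrank_eq
  · refine (injective_iff_map_eq_zero L).2 fun f hf => Subtype.ext (slice_ext fun n => ?_)
    have h := (mem_boxKer.1 f.2).2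
    rw [pow_one] at h
    have h0 : slice 0 f.1 = 0 := congrArg Subtype.val hf
    rw [slice_of_totalShift_eq_zero h, h0, map_zero, smul_zero]
    exact (map_zero _).symm
  · intro g
    have hg := mem_boxKer.1 g.2
    let F : (Fin (s + 1) → ℕ) → k := fun j =>
      (-1) ^ (j 0) * (totalShift k s ^ (j 0)) g.1 (Fin.tail j)
    have hF : ∀ n, slice n F = (-1 : k) ^ n • (totalShift k s ^ n) g.1 := fun n => by
      ext j; simp [F, slice_apply]
    have hmem : F ∈ boxKer k (Fin.cons c a : Fin (s + 1) → ℕ) 1 := by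
      rw [mem_boxKer, mem_box_cons, pow_one]
      refine ⟨⟨fun n => ?_, fun n hn => ?_⟩, slice_ext fun n => ?_⟩
      · rw [hF]
        exact (box k a).smul_mem _ (totalShift_pow_mem_box hg.1 n)
      · rw [hF, (mem_boxKer.1 (boxKer_mono a hn g.2)).2, smul_zero]
      · rw [slice_totalShift, hF, hF, pow_succ', pow_succ' (totalShift k s), Module.End.mul_apply,
          map_zero, map_smul]
        simp
    refine ⟨⟨F, hmem⟩, Subtype.ext ?_⟩
    exact (hF 0).trans (by simp)

theorem linColength_cons_zero (a : Fin s → ℕ) :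
    linColength k (Fin.cons 0 a : Fin (s + 1) → ℕ) = 0 := by
  rw [linColength_cons, boxKer_zero, finrank_bot]

theorem linColength_cons_one (a : Fin s → ℕ) :
    linColength k (Fin.cons 1 a : Fin (s + 1) → ℕ) = linColength k a := linColength_cons 1 a

theorem linColength_comp_equiv (e : Equiv.Perm (Fin s)) (a : Fin s → ℕ) :
    linColength k (a ∘ e) = linColength k a := by
  let E : ((Fin s → ℕ) → k) ≃ₗ[k] ((Fin s → ℕ) → k) :=
    LinearEquiv.funCongrLeft k k (e.symm.arrowCongr (Equiv.refl ℕ))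
  have hE : ∀ f j, E f j = f (j ∘ e) := fun f j => by
    simp [E, LinearEquiv.funCongrLeft, LinearMap.funLeft_apply]; rfl
  have hT : ∀ f, totalShift k s (E f) = E (totalShift k s f) := fun f => by
    ext j
    rw [hE, totalShift_apply, totalShift_apply, ← Equiv.sum_comp e]
    refine Finset.sum_congr rfl fun i _ => ?_
    rw [hE]
    congr 1
    ext x
    simp [Pi.single_apply]
  refine (E.submoduleMap _).finrank_eq.trans (congrArg (fun W : Submodule k _ => finrank k W) ?_)
  ext f
  obtain ⟨f, rfl⟩ := E.surjective f
  simp only [Submodule.mem_map_equiv, LinearEquiv.symm_apply_apply, mem_boxKer, pow_one, hT,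
    LinearEquiv.map_eq_zero_iff]
  refine and_congr_left fun _ => ⟨fun h j i hi => ?_, fun h j i hi => ?_⟩
  · rw [hE]
    exact h _ (e.symm i) (by simpa using hi)
  · have := h (j ∘ e.symm) (e i) (by simpa using hi)
    rw [hE] at this
    simpa [Function.comp_assoc] using this

theorem linColength_cons_cons_swap (x y : ℕ) (a : Fin s → ℕ) :
    linColength k (Fin.cons x (Fin.cons y a : Fin (s + 1) → ℕ) : Fin (s + 2) → ℕ) =
      linColength k (Fin.cons y (Fin.cons x a : Fin (s + 1) → ℕ) : Fin (s + 2) → ℕ) := by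
  rw [← linColength_comp_equiv (Equiv.swap 0 1)]
  congr 1
  ext i
  refine Fin.cases ?_ (fun i => Fin.cases ?_ (fun i => ?_) i) i
  · rw [Function.comp_apply, Equiv.swap_apply_left, Fin.cons_zero, ← Fin.succ_zero_eq_one,
      Fin.cons_succ, Fin.cons_zero]
  · simp
  · rw [Function.comp_apply, Equiv.swap_apply_of_ne_of_ne (Fin.succ_ne_zero _)]
    · simp
    · rw [← Fin.succ_zero_eq_one]
      exact fun h => Fin.succ_ne_zero _ (Fin.succ_injective _ h)

/-- On pairs of slices `T (f, g) = (T f + g, T g)`, so `T ^ (c + 1) (f, g) = (T ^ c u, T ^ (c + 1)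
g)` with `u = T f + (c + 1) g`. As `c + 1` is invertible, `(f, u)` are coordinates, and the kernel
becomes `T ^ (c + 2) f = 0`, `T ^ c u = 0`. -/
theorem finrank_boxKer_cons_two (a : Fin s → ℕ) (c : ℕ) (hc : ((c + 1 : ℕ) : k) ≠ 0) :
    finrank k (boxKer k (Fin.cons 2 a : Fin (s + 1) → ℕ) (c + 1)) =
      finrank k (boxKer k a (c + 2)) + finrank k (boxKer k a c) := by
  have h1 : ∀ n, ∀ f ∈ box k (Fin.cons 2 a : Fin (s + 1) → ℕ),
      slice 1 ((totalShift k (s + 1) ^ n) f) = (totalShift k s ^ n) (slice 1 f) := by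
    intro n
    induction n with
    | zero => simp
    | succ n ih =>
      intro f hf
      rw [pow_succ, Module.End.mul_apply, ih _ (totalShift_mem_box hf), slice_totalShift,
        (mem_box_cons.1 hf).2 2 le_rfl, add_zero, pow_succ, Module.End.mul_apply]
  have h0 : ∀ n, ∀ f ∈ box k (Fin.cons 2 a : Fin (s + 1) → ℕ),
      slice 0 ((totalShift k (s + 1) ^ (n + 1)) f) =
        (totalShift k s ^ n) (totalShift k s (slice 0 f) + ((n + 1 : ℕ) : k) • slice 1 f) := by
    intro n
    induction n with
    | zero => intro f _; simp [slice_totalShift]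
    | succ n ih =>
      intro f hf
      rw [pow_succ, Module.End.mul_apply, ih _ (totalShift_mem_box hf), slice_totalShift,
        slice_totalShift, (mem_box_cons.1 hf).2 2 le_rfl, pow_succ, Module.End.mul_apply]
      congr 1
      simp only [map_add, map_smul, add_zero]
      push_cast
      module
  have hmem : ∀ f ∈ box k (Fin.cons 2 a : Fin (s + 1) → ℕ),
      (totalShift k (s + 1) ^ (c + 1)) f = 0 ↔
      (totalShift k s ^ c) (totalShift k s (slice 0 f) + ((c + 1 : ℕ) : k) • slice 1 f) = 0 ∧
        (totalShift k s ^ (c + 1)) (slice 1 f) = 0 := by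
    intro f hf
    rw [← h0 c f hf, ← h1 (c + 1) f hf]
    constructor
    · intro h; simp [h]
    · rintro ⟨ha, hb⟩
      have hb' := (mem_box_cons.1 (totalShift_pow_mem_box hf (c + 1))).2
      refine slice_ext fun n => ?_
      rw [map_zero]
      match n with
      | 0 => exact ha
      | 1 => exact hb
      | n + 2 => exact hb' _ (by omega)
  let L₁ : boxKer k (Fin.cons 2 a : Fin (s + 1) → ℕ) (c + 1) →ₗ[k] boxKer k a (c + 2) :=
    ((slice 0).domRestrict _).codRestrict _ fun f => by
      have hf := mem_boxKer.1 f.2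
      obtain ⟨ha, hb⟩ := (hmem _ hf.1).1 hf.2
      refine mem_boxKer.2 ⟨(mem_box_cons.1 hf.1).1 0, ?_⟩
      have h := congrArg (totalShift k s) ha
      rw [← Module.End.mul_apply, ← pow_succ', map_add, map_smul, hb, smul_zero, add_zero,
        map_zero, ← Module.End.mul_apply, ← pow_succ] at h
      exact h
  let L₂ : boxKer k (Fin.cons 2 a : Fin (s + 1) → ℕ) (c + 1) →ₗ[k] boxKer k a c :=
    ((totalShift k s ∘ₗ slice 0 + ((c + 1 : ℕ) : k) • slice 1).domRestrict _).codRestrict _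
      fun f => by
        have hf := mem_boxKer.1 f.2
        have hs := (mem_box_cons.1 hf.1).1
        exact mem_boxKer.2 ⟨(box k a).add_mem (totalShift_mem_box (hs 0))
          ((box k a).smul_mem _ (hs 1)), ((hmem _ hf.1).1 hf.2).1⟩
  rw [← finrank_prod]
  refine (LinearEquiv.ofBijective (L₁.prod L₂) ⟨?_, ?_⟩).finrank_eq
  · refine (injective_iff_map_eq_zero _).2 fun f hf => Subtype.ext (slice_ext fun n => ?_)
    have e0 : slice 0 f.1 = 0 := congrArg (fun z => z.1.1) hf
    have e1 : totalShift k s (slice 0 f.1) + ((c + 1 : ℕ) : k) • slice 1 f.1 = 0 :=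
      congrArg (fun z => z.2.1) hf
    rw [e0, map_zero, zero_add, smul_eq_zero_iff_right hc] at e1
    match n with
    | 0 => exact e0
    | 1 => exact e1
    | n + 2 => exact (mem_box_cons.1 f.2.1).2 _ (by omega)
  · rintro ⟨⟨f, hf⟩, ⟨u, hu⟩⟩
    rw [mem_boxKer] at hf hu
    let g : (Fin s → ℕ) → k := ((c + 1 : ℕ) : k)⁻¹ • (u - totalShift k s f)
    have hg : totalShift k s f + ((c + 1 : ℕ) : k) • g = u := by
      rw [smul_inv_smul₀ hc]; abel
    let F : (Fin (s + 1) → ℕ) → k := fun j =>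
      if j 0 = 0 then f (Fin.tail j) else if j 0 = 1 then g (Fin.tail j) else 0
    have F0 : slice 0 F = f := by ext j; simp [F, slice_apply]
    have F1 : slice 1 F = g := by ext j; simp [F, slice_apply]
    have F2 : ∀ n, 2 ≤ n → slice n F = 0 := fun n hn => by
      ext j
      simp [F, slice_apply, show n ≠ 0 by omega, show n ≠ 1 by omega]
    have hgbox : g ∈ box k a :=
      (box k a).smul_mem _ ((box k a).sub_mem hu.1 (totalShift_mem_box hf.1))
    have hF : F ∈ box k (Fin.cons 2 a : Fin (s + 1) → ℕ) := by
      refine mem_box_cons.2 ⟨fun n => ?_, F2⟩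
      match n with
      | 0 => rw [F0]; exact hf.1
      | 1 => rw [F1]; exact hgbox
      | n + 2 => rw [F2 _ (by omega)]; exact zero_mem _
    have hFK : F ∈ boxKer k (Fin.cons 2 a : Fin (s + 1) → ℕ) (c + 1) := by
      refine mem_boxKer.2 ⟨hF, (hmem F hF).2 ?_⟩
      rw [F0, F1, hg]
      refine ⟨hu.2, ?_⟩
      rw [map_smul, map_sub, ← Module.End.mul_apply _ (totalShift k s), ← pow_succ, hf.2, pow_succ',
        Module.End.mul_apply, hu.2, map_zero, sub_zero, smul_zero]
    refine ⟨⟨F, hFK⟩, Prod.ext (Subtype.ext F0) (Subtype.ext ?_)⟩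
    change totalShift k s (slice 0 F) + ((c + 1 : ℕ) : k) • slice 1 F = u
    rw [F0, F1, hg]

/-- The decomposition of the tensor product of Jordan blocks of sizes `2` and `c + 1`. -/
theorem linColength_cons_two_cons (c : ℕ) (hc : ((c + 1 : ℕ) : k) ≠ 0) (a : Fin s → ℕ) :
    linColength k (Fin.cons 2 (Fin.cons (c + 1) a : Fin (s + 1) → ℕ) : Fin (s + 2) → ℕ) =
      linColength k (Fin.cons (c + 2) a : Fin (s + 1) → ℕ) +
        linColength k (Fin.cons c a : Fin (s + 1) → ℕ) := by
  rw [linColength_cons_cons_swap, linColength_cons, linColength_cons, linColength_cons,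
    finrank_boxKer_cons_two a c hc]

/-- The index of the box in which the residue class `r` modulo `d` of the box `b` lies. -/
def residueBox (d b : Fin s → ℕ) (r : ∀ i, Fin (d i)) (i : Fin s) : ℕ :=
  (b i + d i - 1 - r i) / d i

/-- The box index is `⌈(b i - r i) / d i⌉`; since `r i < d i`, the subtractions in its definition do
not truncate. -/
theorem residueBox_le_iff {d b : Fin s → ℕ} (r : ∀ i, Fin (d i)) (i : Fin s) (n : ℕ) :
    residueBox d b r i ≤ n ↔ b i ≤ r i + d i * n := by
  have h := (r i).2
  rw [residueBox, ← Nat.lt_succ_iff, Nat.div_lt_iff_lt_mul (by omega), Nat.succ_mul, mul_comm n]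
  omega

/-- Splitting functions according to residue classes modulo `d`. -/
theorem finrank_box_inf_ker_diagonal (d b : Fin s → ℕ) (hd : ∀ i, 0 < d i) (c : ℕ) :
    finrank k ↥(box k b ⊓ LinearMap.ker ((∑ i, shift k i ^ d i) ^ c)) =
      ∑ r : (∀ i, Fin (d i)), finrank k (boxKer k (residueBox d b r) c) := by
  set B : Module.End k ((Fin s → ℕ) → k) := ∑ i, shift k i ^ d i with hB
  let R : (∀ i, Fin (d i)) → ((Fin s → ℕ) → k) →ₗ[k] ((Fin s → ℕ) → k) := fun r =>
    LinearMap.funLeft k k fun j i => r i + d i * j i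
  have hR : ∀ r f j, R r f j = f fun i => r i + d i * j i := fun _ _ _ => rfl
  -- Moving by `d i` in coordinate `i` keeps the residue and raises the quotient by one.
  have hRB : ∀ r f, R r (B f) = totalShift k s (R r f) := fun r f => by
    ext j
    simp only [hB, hR, totalShift_apply, LinearMap.sum_apply, Finset.sum_apply, shift_pow_apply]
    refine Finset.sum_congr rfl fun i _ => congrArg f ?_
    ext x
    by_cases h : x = i
    · subst h; simp; ring
    · simp [h]
  have hRB' : ∀ n r f, R r ((B ^ n) f) = (totalShift k s ^ n) (R r f) := fun n => by
    induction n with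
    | zero => simp
    | succ n ih =>
      intro r f
      rw [pow_succ, Module.End.mul_apply, ih, hRB, pow_succ, Module.End.mul_apply]
  have hRext : ∀ f g, (∀ r, R r f = R r g) → f = g := fun f g h => by
    ext j
    have := congrFun (h fun i => ⟨j i % d i, Nat.mod_lt _ (hd i)⟩) fun i => j i / d i
    simpa [hR, Nat.mod_add_div] using this
  have hbox : ∀ f, f ∈ box k b ↔ ∀ r, R r f ∈ box k (residueBox d b r) := fun f => by
    constructor
    · intro h r j i hi
      exact h _ i ((residueBox_le_iff r i _).1 hi)
    · intro h j i hi
      have := h (fun i => ⟨j i % d i, Nat.mod_lt _ (hd i)⟩) (fun i => j i / d i) i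
        ((residueBox_le_iff _ i _).2 (by simpa [Nat.mod_add_div] using hi))
      simpa [hR, Nat.mod_add_div] using this
  have hmem : ∀ f, f ∈ box k b ⊓ LinearMap.ker (B ^ c) ↔
      ∀ r, R r f ∈ boxKer k (residueBox d b r) c := fun f => by
    simp only [mem_boxKer, Submodule.mem_inf, LinearMap.mem_ker, hbox f, forall_and]
    refine and_congr_right fun _ => ⟨fun h r => ?_, fun h => hRext _ _ fun r => ?_⟩
    · rw [← hRB', h, map_zero]
    · rw [hRB', h, map_zero]
  let L : ↥(box k b ⊓ LinearMap.ker (B ^ c)) →ₗ[k]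
      ((r : ∀ i, Fin (d i)) → boxKer k (residueBox d b r) c) :=
    LinearMap.pi fun r => ((R r).domRestrict _).codRestrict _ fun f => (hmem f.1).1 f.2 r
  rw [← Module.finrank_pi_fintype]
  refine (LinearEquiv.ofBijective L ⟨?_, ?_⟩).finrank_eq
  · intro f g h
    exact Subtype.ext (hRext _ _ fun r => congrArg Subtype.val (congrFun h r))
  · intro g
    let f : (Fin s → ℕ) → k := fun j =>
      (g fun i => ⟨j i % d i, Nat.mod_lt _ (hd i)⟩).1 fun i => j i / d i
    have hf : ∀ r, R r f = (g r).1 := fun r => by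
      ext j
      have e1 : (fun i => ⟨(r i + d i * j i) % d i, Nat.mod_lt _ (hd i)⟩ : ∀ i, Fin (d i)) = r := by
        ext i; simp [Nat.mod_eq_of_lt (r i).2]
      have e2 : (fun i => (r i + d i * j i) / d i) = j := by
        ext i
        rw [Nat.add_mul_div_left _ _ (hd i), Nat.div_eq_of_lt (r i).2, zero_add]
      simp only [hR, f, e2]
      exact congrArg (fun r => (g r).1 j) e1
    exact ⟨⟨f, (hmem f).2 fun r => by rw [hf]; exact (g r).2⟩,
      funext fun r => Subtype.ext (hf r)⟩

/-! ### Frobenius in characteristic `p` -/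

section CharP

variable (p : ℕ) [Fact p.Prime] [CharP k p]

theorem totalShift_pow_char : totalShift k s ^ p = ∑ i, shift k i ^ p := by
  have : CharP (Module.End k ((Fin s → ℕ) → k)) p :=
    charP_of_injective_algebraMap (FaithfulSMul.algebraMap_injective k _) p
  have key : ∀ t : Finset (Fin s), (∑ i ∈ t, shift k i) ^ p = ∑ i ∈ t, shift k i ^ p := fun t => by
    induction t using Finset.induction_on with
    | empty => simp [(Fact.out : p.Prime).ne_zero]
    | insert i t hi ih =>
      rw [Finset.sum_insert hi, Finset.sum_insert hi, add_pow_char_of_commute, ih]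
      exact Commute.sum_right _ _ _ fun j _ => shift_commute i j
  exact key _

/-- Each `p`-th power of a coordinate shift moves the whole box off itself. -/
theorem boxKer_char (a : Fin s → ℕ) (ha : ∀ i, a i ≤ p) : boxKer k a p = box k a := by
  refine inf_eq_left.2 fun f hf => ?_
  rw [LinearMap.mem_ker, totalShift_pow_char, LinearMap.sum_apply]
  refine Finset.sum_eq_zero fun i _ => ?_
  ext j
  rw [shift_pow_apply]
  exact hf _ i ((ha i).trans (by simp))

theorem linColength_cons_char (a : Fin s → ℕ) (ha : ∀ i, a i ≤ p) :
    linColength k (Fin.cons p a : Fin (s + 1) → ℕ) = ∏ i, a i := by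
  rw [linColength_cons, boxKer_char p a ha, finrank_box]

/-- After trading the first variable for `T ^ (p * a 0) = (∑ shift ^ p) ^ (a 0)`, the functions
split by residues modulo `p` into `p ^ s` copies of the problem for `a`. -/
theorem linColength_char_mul (a : Fin (s + 1) → ℕ) :
    linColength k (fun i => p * a i) = p ^ s * linColength k a := by
  have hp := (Fact.out : p.Prime).pos
  have h1 : (fun i => p * a i) = (Fin.cons (p * a 0) fun i => p * a i.succ : Fin (s + 1) → ℕ) := by
    ext i; refine Fin.cases ?_ (fun i => ?_) i <;> simp
  have h2 := finrank_box_inf_ker_diagonal (k := k) (fun _ : Fin s => p) (fun i => p * a i.succ)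
    (fun _ => hp) (a 0)
  have h3 : ∀ r : Fin s → Fin p, residueBox (fun _ => p) (fun i => p * a i.succ) r =
      Fin.tail a := fun r => by
    ext i
    apply eq_of_forall_ge_iff
    intro n
    rw [residueBox_le_iff]
    have := (r i).2
    constructor
    · intro h
      by_contra hn
      have : n + 1 ≤ a i.succ := by simpa [Fin.tail] using hn
      nlinarith [Nat.mul_le_mul_left p this]
    · intro h
      exact (Nat.mul_le_mul_left p h).trans (Nat.le_add_left _ _)
  rw [h1, linColength_cons]
  rw [← totalShift_pow_char, ← pow_mul] at h2
  rw [boxKer, h2, Finset.sum_congr rfl fun r _ => by rw [h3 r]]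
  rw [Finset.sum_const, ← linColength_cons (a 0) (Fin.tail a), Fin.cons_self_tail]
  simp

end CharP

/-! ### Monotonicity and Lipschitz bounds for the colength -/

theorem linColength_le_prod_tail (a : Fin (s + 1) → ℕ) :
    linColength k a ≤ ∏ i : Fin s, a i.succ := by
  conv_lhs => rw [← Fin.cons_self_tail a]
  rw [linColength_cons]
  exact finrank_boxKer_le _ _

/-- By symmetry the first exponent grows, that is, `ker T ^ c` becomes `ker T ^ (c + 1)` on the
remaining `s + 1` variables. The growth is at most their colength, which is bounded by a product of
`s` exponents. -/
theorem linColength_add_single {N : ℕ} (a : Fin (s + 2) → ℕ) (ha : ∀ i, a i ≤ N)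
    (i : Fin (s + 2)) :
    linColength k a ≤ linColength k (a + Pi.single i 1) ∧
      linColength k (a + Pi.single i 1) ≤ linColength k a + N ^ s := by
  wlog hi : i = 0 generalizing a i
  · have h := this (a ∘ Equiv.swap 0 i) (fun _ => ha _) 0 rfl
    have e : a ∘ Equiv.swap 0 i + Pi.single 0 1 = (a + Pi.single i 1) ∘ Equiv.swap 0 i := by
      ext x
      simp [Pi.single_apply, Equiv.swap_apply_eq_iff]
    rwa [e, linColength_comp_equiv, linColength_comp_equiv] at h
  subst hi
  have e : a + Pi.single 0 1 = (Fin.cons (a 0 + 1) (Fin.tail a) : Fin (s + 2) → ℕ) := by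
    ext x
    refine Fin.cases ?_ (fun x => ?_) x <;> simp [Fin.tail]
  have e' : linColength k a = linColength k (Fin.cons (a 0) (Fin.tail a) : Fin (s + 2) → ℕ) := by
    rw [Fin.cons_self_tail]
  rw [e, e', linColength_cons, linColength_cons]
  refine ⟨Submodule.finrank_mono (boxKer_mono _ (Nat.le_succ _)),
    (finrank_boxKer_succ_le _ _).trans (Nat.add_le_add_left ?_ _)⟩
  refine (linColength_le_prod_tail _).trans ((Finset.prod_le_pow_card _ _ N fun i _ => ha _).trans ?_)
  simp

theorem linColength_mono_lipschitz {N : ℕ} {a b : Fin (s + 2) → ℕ} (hab : a ≤ b)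
    (hb : ∀ i, b i ≤ N) :
    linColength k a ≤ linColength k b ∧
      linColength k b ≤ linColength k a + (∑ i, (b i - a i)) * N ^ s := by
  induction hn : ∑ i, (b i - a i) generalizing a with
  | zero =>
    have : a = b := le_antisymm hab fun i =>
      Nat.sub_eq_zero_iff_le.1 (Finset.sum_eq_zero_iff.1 hn i (Finset.mem_univ i))
    subst this
    simp
  | succ n ih =>
    obtain ⟨i, hi⟩ : ∃ i, a i < b i := by
      by_contra! h
      rw [Finset.sum_eq_zero fun i _ => Nat.sub_eq_zero_of_le (h i)] at hn
      omega
    have hle : a + Pi.single i 1 ≤ b := fun x => by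
      by_cases hx : x = i
      · subst hx; simpa using hi
      · simpa [hx] using hab x
    have hsum : ∑ x, (b x - (a + Pi.single i 1 : Fin (s + 2) → ℕ) x) = n := by
      have : ∑ x, (b x - a x) = ∑ x, (b x - (a + Pi.single i 1 : Fin (s + 2) → ℕ) x) +
          ∑ x, Pi.single (M := fun _ => ℕ) i 1 x := by
        rw [← Finset.sum_add_distrib]
        refine Finset.sum_congr rfl fun x _ => ?_
        have := hle x
        simp only [Pi.add_apply] at this ⊢
        omega
      rw [hn, Finset.sum_pi_single'] at this
      simpa using this.symm
    have h1 := ih hle hsum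
    have h2 := linColength_add_single (k := k) a (fun i => (hab i).trans (hb i)) i
    refine ⟨h2.1.trans h1.1, h1.2.trans ?_⟩
    rw [add_mul, one_mul]
    omega

end Operators

end DiagonalHK

namespace DiagonalHK

open Module

/-! ### Length as dimension -/

section Length

variable {k : Type*} [Field k] {σ : Type*}

/-- On a module over a polynomial ring killed by the variables the scalars act through constants. -/
theorem smul_eq_constantCoeff_smul {M : Type*} [AddCommGroup M] [Module (MvPolynomial σ k) M]
    [Module k M] [IsScalarTower k (MvPolynomial σ k) M]
    (h : ∀ (i : σ) (m : M), (MvPolynomial.X i : MvPolynomial σ k) • m = 0)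
    (f : MvPolynomial σ k) (m : M) : f • m = MvPolynomial.constantCoeff f • m := by
  induction f using MvPolynomial.induction_on with
  | C a => rw [MvPolynomial.constantCoeff_C, ← MvPolynomial.algebraMap_eq, algebraMap_smul]
  | add f g hf hg => rw [add_smul, hf, hg, map_add, add_smul]
  | mul_X f i hf => rw [mul_smul, h, smul_zero]; simp

/-- Over a polynomial ring, length is dimension for modules on which the variables are nilpotent. -/
theorem length_eq_finrank_of_nilpotent {M : Type*} [AddCommGroup M] [Module (MvPolynomial σ k) M]
    [Module k M] [IsScalarTower k (MvPolynomial σ k) M] [FiniteDimensional k M]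
    (h : ∀ i : σ, ∃ n : ℕ, ∀ m : M, (MvPolynomial.X i ^ n : MvPolynomial σ k) • m = 0) :
    Module.length (MvPolynomial σ k) M = finrank k M := by
  induction hn : finrank k M generalizing M with
  | zero =>
    have := Module.finrank_zero_iff.1 hn
    simp
  | succ n ih =>
    have : Nontrivial M := Module.nontrivial_of_finrank_pos (R := k) (by omega)
    have : IsArtinian (MvPolynomial σ k) M := isArtinian_of_tower k inferInstance
    obtain ⟨N, hN⟩ := IsAtomic.exists_atom (Submodule (MvPolynomial σ k) M)
    have hsimple : IsSimpleModule (MvPolynomial σ k) N := isSimpleModule_iff_isAtom.2 hN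
    have hkill : ∀ (i : σ) (m : N), (MvPolynomial.X i : MvPolynomial σ k) • m = 0 := by
      intro i
      -- Schur's lemma: a variable acts on a simple submodule injectively or by zero, and nilpotency
      -- excludes the former. So only constants act, and the submodule is a line over `k`.
      rcases LinearMap.injective_or_eq_zero (LinearMap.lsmul (MvPolynomial σ k) N
        (MvPolynomial.X i : MvPolynomial σ k)) with hinj | h0
      · exfalso
        obtain ⟨e, he⟩ := h i
        have : Nontrivial N := IsSimpleModule.nontrivial (MvPolynomial σ k) N
        obtain ⟨x, hx⟩ := exists_ne (0 : N)
        refine hx (hinj.iterate e ?_)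
        have key : ∀ (t : ℕ) (y : N), (LinearMap.lsmul (MvPolynomial σ k) N
            (MvPolynomial.X i : MvPolynomial σ k))^[t] y =
              (MvPolynomial.X i ^ t : MvPolynomial σ k) • y := fun t y => by
          induction t with
          | zero => simp
          | succ t iht => rw [Function.iterate_succ_apply', iht, LinearMap.lsmul_apply, smul_smul,
              pow_succ']
        rw [key, key, smul_zero]
        exact Subtype.ext (he x)
      · exact fun m => LinearMap.congr_fun h0 m
    have hN1 : finrank k N = 1 := by
      rw [finrank_eq_one_iff']
      have : Nontrivial N := IsSimpleModule.nontrivial (MvPolynomial σ k) N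
      obtain ⟨x, hx⟩ := exists_ne (0 : N)
      refine ⟨x, hx, fun w => ?_⟩
      obtain ⟨f, hf⟩ := IsSimpleModule.toSpanSingleton_surjective (MvPolynomial σ k) hx w
      refine ⟨MvPolynomial.constantCoeff f, ?_⟩
      rw [← smul_eq_constantCoeff_smul hkill]
      exact hf
    have hq : finrank k (M ⧸ N) = n := by
      have := Submodule.finrank_quotient_add_finrank (N.restrictScalars k)
      have e : finrank k (N.restrictScalars k) = 1 := hN1
      have e' : finrank k (M ⧸ N.restrictScalars k) = finrank k (M ⧸ N) :=
        (Submodule.Quotient.restrictScalarsEquiv k N).finrank_eq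
      omega
    have : FiniteDimensional k (M ⧸ N) :=
      Module.Finite.equiv (Submodule.Quotient.restrictScalarsEquiv k N)
    rw [Module.length_eq_add_of_exact N.subtype N.mkQ N.subtype_injective N.mkQ_surjective
      (LinearMap.exact_subtype_mkQ N), Module.length_eq_one, ih (M := M ⧸ N) (fun i => ?_) hq]
    · push_cast; ring
    · obtain ⟨e, he⟩ := h i
      refine ⟨e, fun m => ?_⟩
      obtain ⟨m, rfl⟩ := N.mkQ_surjective m
      rw [← map_smul, he, map_zero]

end Length

/-! ### Macaulay duality -/

section Duality

variable {k : Type*} [Field k] {s : ℕ}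

/-- Linear functionals killing the ideal generated by `∑ X i ^ d i` and the `X i ^ b i`, as functions
on exponents. -/
theorem exists_dual_quotient_equiv (d b : Fin s → ℕ) :
    Nonempty (Dual k (MvPolynomial (Fin s) k ⧸ Ideal.span
      (insert (∑ i, MvPolynomial.X i ^ d i : MvPolynomial (Fin s) k)
        (Set.range fun i : Fin s => MvPolynomial.X i ^ b i))) ≃ₗ[k]
      ↥(box k b ⊓ LinearMap.ker (∑ i, shift k i ^ d i))) := by
  set J := Ideal.span (insert (∑ i, MvPolynomial.X i ^ d i : MvPolynomial (Fin s) k)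
        (Set.range fun i : Fin s => MvPolynomial.X i ^ b i)) with hJ
  let mon : (Fin s → ℕ) → MvPolynomial (Fin s) k := fun j =>
    MvPolynomial.monomial (Finsupp.equivFunOnFinite.symm j) 1
  have hmon : ∀ j i n, mon j * MvPolynomial.X i ^ n = mon (j + Pi.single i n) := fun j i n => by
    simp only [mon, MvPolynomial.X_pow_eq_monomial, MvPolynomial.monomial_mul, one_mul]
    congr 2
    ext x
    simp [Finsupp.single_apply, Pi.single_apply, eq_comm]
  have hJX : ∀ (j : Fin s → ℕ) (i : Fin s) (n : ℕ), b i ≤ n → mon (j + Pi.single i n) ∈ J := fun j i n hn => by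
    rw [← hmon]
    refine Ideal.mul_mem_left _ _ (Ideal.mem_of_dvd _ (pow_dvd_pow _ hn) ?_)
    exact Ideal.subset_span (Or.inr ⟨i, rfl⟩)
  have hJh : ∀ j : Fin s → ℕ, ∑ i, mon (j + Pi.single i (d i)) ∈ J := fun j => by
    simp_rw [← hmon, ← Finset.mul_sum]
    exact Ideal.mul_mem_left _ _ (Ideal.subset_span (Or.inl rfl))
  let L₀ : Dual k (MvPolynomial (Fin s) k ⧸ J) →ₗ[k] ((Fin s → ℕ) → k) :=
    LinearMap.pi fun j => LinearMap.applyₗ (Ideal.Quotient.mk J (mon j))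
  have hL₀ : ∀ φ j, L₀ φ j = φ (Ideal.Quotient.mk J (mon j)) := fun _ _ => rfl
  let L := L₀.codRestrict (box k b ⊓ LinearMap.ker (∑ i, shift k i ^ d i)) fun φ => by
    refine ⟨fun j i hi => ?_, ?_⟩
    · have e : j = (fun x => if x = i then 0 else j x) + Pi.single i (j i) := by
        ext x
        by_cases h : x = i
        · subst h; simp
        · simp [h]
      rw [hL₀, e, Ideal.Quotient.eq_zero_iff_mem.2 (hJX _ i _ hi), map_zero]
    · refine LinearMap.mem_ker.2 (funext fun j => ?_)
      simp only [LinearMap.sum_apply, Finset.sum_apply, shift_pow_apply, hL₀]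
      rw [← map_sum, ← map_sum, Ideal.Quotient.eq_zero_iff_mem.2 (hJh j), map_zero]
      rfl
  refine ⟨LinearEquiv.ofBijective L ⟨?_, ?_⟩⟩
  · refine (injective_iff_map_eq_zero L).2 fun φ hφ => ?_
    have h0 : L₀ φ = 0 := congrArg Subtype.val hφ
    have h1 : φ ∘ₗ (Ideal.Quotient.mkₐ k J).toLinearMap = 0 := by
      refine (MvPolynomial.basisMonomials (Fin s) k).ext fun m => ?_
      have := congrFun h0 m
      rw [hL₀] at this
      simpa [mon] using this
    refine LinearMap.ext fun x => ?_
    obtain ⟨x, rfl⟩ := Ideal.Quotient.mk_surjective x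
    exact LinearMap.congr_fun h1 x
  · rintro ⟨f, hf1, hf2⟩
    -- The functional with values `f` on monomials; it descends to the quotient once it kills all
    -- monomial multiples of the generators.
    let ψ : MvPolynomial (Fin s) k →ₗ[k] k :=
      (MvPolynomial.basisMonomials (Fin s) k).constr k fun m => f m
    have hψ : ∀ j, ψ (mon j) = f j := fun j => by
      have := (MvPolynomial.basisMonomials (Fin s) k).constr_basis k
        (fun m : Fin s →₀ ℕ => f m) (Finsupp.equivFunOnFinite.symm j)
      simpa [mon] using this
    have hgen : ∀ g : MvPolynomial (Fin s) k, (∀ j, ψ (mon j * g) = 0) → ∀ x, ψ (x * g) = 0 := by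
      intro g hg x
      have : ψ ∘ₗ LinearMap.mulRight k g = 0 := by
        refine (MvPolynomial.basisMonomials (Fin s) k).ext fun m => ?_
        simpa [mon] using hg m
      exact LinearMap.congr_fun this x
    have hker : ∀ x ∈ J, ∀ y, ψ (y * x) = 0 := by
      intro x hx
      induction hx using Submodule.span_induction with
      | mem x hx =>
        refine hgen x fun j => ?_
        rcases hx with rfl | ⟨i, rfl⟩
        · rw [Finset.mul_sum, map_sum]
          simp_rw [hmon, hψ]
          have := congrFun (LinearMap.mem_ker.1 hf2) j
          simpa [shift_pow_apply] using this
        · rw [hmon, hψ]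
          exact hf1 _ i (by simp)
      | zero => simp
      | add x y _ _ hx hy => intro z; rw [mul_add, map_add, hx, hy, add_zero]
      | smul a x _ hx => intro z; rw [smul_eq_mul, ← mul_assoc]; exact hx _
    refine ⟨(J.restrictScalars k).liftQ ψ (fun x hx => by
      simpa using hker x hx 1) ∘ₗ (Submodule.Quotient.restrictScalarsEquiv k J).symm.toLinearMap,
      Subtype.ext (funext fun j => ?_)⟩
    exact hψ j

theorem hkColength_diagonalForm (p : ℕ) [Fact p.Prime] (d : Fin s → ℕ) (hd : ∀ i, 0 < d i)
    (n : ℕ) : hkColength (diagonalForm p d) n =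
      ((∑ r : (∀ i, Fin (d i)), linColength (ZMod p) (residueBox d (fun _ => p ^ n) r) : ℕ) : ℕ∞)
    := by
  obtain ⟨e⟩ := exists_dual_quotient_equiv (k := ZMod p) d (fun _ => p ^ n)
  have hfin : FiniteDimensional (ZMod p)
      ↥(box (ZMod p) (fun _ : Fin s => p ^ n) ⊓ LinearMap.ker (∑ i, shift (ZMod p) i ^ d i)) :=
    Submodule.finiteDimensional_of_le inf_le_left
  have hfin' := Module.finite_dual_iff (ZMod p) |>.1 (Module.Finite.equiv e.symm)
  have h := finrank_box_inf_ker_diagonal (k := ZMod p) d (fun _ => p ^ n) hd 1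
  rw [pow_one] at h
  unfold linColength
  rw [← h, ← e.finrank_eq, Subspace.dual_finrank_eq, hkColength, diagonalForm]
  refine length_eq_finrank_of_nilpotent fun i => ⟨p ^ n, fun m => ?_⟩
  obtain ⟨m, rfl⟩ := Ideal.Quotient.mk_surjective m
  rw [← Ideal.Quotient.mk_eq_mk, ← Submodule.Quotient.mk_smul, Submodule.Quotient.mk_eq_zero,
    smul_eq_mul]
  exact Ideal.mul_mem_right _ _ (Ideal.subset_span (Or.inr ⟨i, rfl⟩))

end Duality

end DiagonalHK

namespace DiagonalHK

open Module

/-! ### Counting box points by residue of the degree -/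

section ResidueCount

open Polynomial

/-- The sum of the coefficients of a polynomial in the degrees congruent to `c` modulo `p`. -/
noncomputable def residueSum (p : ℕ) (c : ZMod p) : ℤ[X] →ₗ[ℤ] ℤ :=
  Polynomial.lsum fun m => if (m : ZMod p) = c then LinearMap.id else 0

/-- The polynomial `1 + X + ⋯ + X ^ (n - 1)`. -/
noncomputable def geomPoly (n : ℕ) : ℤ[X] := ∑ j ∈ Finset.range n, X ^ j

/-- The number of points `j` of the box `a`, `j i < a i`, with `∑ j i` congruent modulo `p` to the
middle value `⌊∑ (a i - 1) / 2⌋`, as a sum of coefficients of `∏ (1 + X + ⋯ + X ^ (a i - 1))`. -/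
noncomputable def middleCount (p : ℕ) {s : ℕ} (a : Fin s → ℕ) : ℤ :=
  residueSum p ((((∑ i, (a i : ℤ)) - s) / 2 : ℤ) : ZMod p) (∏ i, geomPoly (a i))

theorem residueSum_monomial (p : ℕ) (c : ZMod p) (m : ℕ) (x : ℤ) :
    residueSum p c (monomial m x) = if (m : ZMod p) = c then x else 0 := by
  rw [residueSum, lsum_apply, sum_monomial_index]
  · split_ifs <;> rfl
  · simp

theorem residueSum_X_pow (p : ℕ) (c : ZMod p) (m : ℕ) :
    residueSum p c (X ^ m) = if (m : ZMod p) = c then 1 else 0 := by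
  rw [X_pow_eq_monomial, residueSum_monomial]

theorem residueSum_X_mul (p : ℕ) (c : ZMod p) (f : ℤ[X]) :
    residueSum p (c + 1) (X * f) = residueSum p c f := by
  induction f using Polynomial.induction_on' with
  | add f g hf hg => rw [mul_add, map_add, map_add, hf, hg]
  | monomial m x =>
    rw [X_mul_monomial, residueSum_monomial, residueSum_monomial]
    simp

theorem natCast_zmod_eq_iff {p j n : ℕ} (hj : j < p) (hn : n < p) :
    (j : ZMod p) = (n : ZMod p) ↔ j = n := by
  rw [ZMod.natCast_eq_natCast_iff', Nat.mod_eq_of_lt hj, Nat.mod_eq_of_lt hn]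

/-- Among `p` consecutive degrees each residue class occurs exactly once. -/
theorem residueSum_geomPoly_mul (p : ℕ) [NeZero p] (c : ZMod p) (f : ℤ[X]) :
    residueSum p c (geomPoly p * f) = f.eval 1 := by
  induction f using Polynomial.induction_on' with
  | add f g hf hg => rw [mul_add, map_add, hf, hg, eval_add]
  | monomial m x =>
    have h : ∀ j ∈ Finset.range p, residueSum p c (X ^ j * monomial m x) =
        if j = (c - m).val then x else 0 := fun j hj => by
      rw [X_pow_mul_monomial, residueSum_monomial]
      refine if_congr ?_ rfl rfl
      rw [Nat.cast_add, add_comm, ← eq_sub_iff_add_eq, ← natCast_zmod_eq_iff (Finset.mem_range.1 hj)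
        (ZMod.val_lt _), ZMod.natCast_zmod_val]
    rw [geomPoly, Finset.sum_mul, map_sum, Finset.sum_congr rfl h, Finset.sum_ite_eq',
      if_pos (Finset.mem_range.2 (ZMod.val_lt _))]
    simp

theorem geomPoly_zero : geomPoly 0 = 0 := rfl

theorem geomPoly_one : geomPoly 1 = 1 := by simp [geomPoly]

theorem geomPoly_eval_one (n : ℕ) : (geomPoly n).eval 1 = n := by
  simp [geomPoly, eval_finsetSum]

theorem geomPoly_mul_one_sub (n : ℕ) : geomPoly n * (1 - X) = 1 - X ^ n :=
  geom_sum_mul_neg X n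

theorem geomPoly_add_two (n : ℕ) :
    geomPoly (n + 2) + X * geomPoly n = (1 + X) * geomPoly (n + 1) := by
  have h1 : geomPoly (n + 2) = geomPoly (n + 1) + X ^ (n + 1) := Finset.sum_range_succ _ _
  have h2 : geomPoly (n + 1) = geomPoly n + X ^ n := Finset.sum_range_succ _ _
  rw [h1, h2]
  ring

variable {s : ℕ}

theorem middleCount_cons_zero (p : ℕ) (a : Fin s → ℕ) :
    middleCount p (Fin.cons 0 a : Fin (s + 1) → ℕ) = 0 := by
  simp [middleCount, Fin.prod_univ_succ, geomPoly_zero]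

theorem middleCount_cons_one (p : ℕ) (a : Fin s → ℕ) :
    middleCount p (Fin.cons 1 a : Fin (s + 1) → ℕ) = middleCount p a := by
  simp only [middleCount, Fin.prod_univ_succ, Fin.sum_univ_succ, Fin.cons_zero, Fin.cons_succ,
    geomPoly_one, one_mul]
  push_cast
  rw [show (1 : ℤ) + ∑ i, (a i : ℤ) - (s + 1) = ∑ i, (a i : ℤ) - s by ring]

theorem middleCount_cons_cons_swap (p x y : ℕ) (a : Fin s → ℕ) :
    middleCount p (Fin.cons x (Fin.cons y a : Fin (s + 1) → ℕ) : Fin (s + 2) → ℕ) =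
      middleCount p (Fin.cons y (Fin.cons x a : Fin (s + 1) → ℕ) : Fin (s + 2) → ℕ) := by
  simp only [middleCount, Fin.prod_univ_succ, Fin.sum_univ_succ, Fin.cons_zero, Fin.cons_succ]
  rw [mul_left_comm, add_left_comm]

theorem middleCount_cons_self (p : ℕ) [NeZero p] (a : Fin s → ℕ) :
    middleCount p (Fin.cons p a : Fin (s + 1) → ℕ) = ∏ i, (a i : ℤ) := by
  simp only [middleCount, Fin.prod_univ_succ, Fin.cons_zero, Fin.cons_succ]
  rw [residueSum_geomPoly_mul, eval_prod]
  simp [geomPoly_eval_one]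

theorem middleCount_singleton (p b : ℕ) (hb : 0 < b) (hbp : b ≤ p) (a : Fin 0 → ℕ) :
    middleCount p (Fin.cons b a : Fin 1 → ℕ) = 1 := by
  have e : ((b : ℤ) - 1) / 2 = (((b - 1) / 2 : ℕ) : ℤ) := by omega
  have h : ∀ j ∈ Finset.range b, residueSum p (((b - 1) / 2 : ℕ) : ZMod p) (X ^ j) =
      if j = (b - 1) / 2 then 1 else 0 := fun j hj => by
    rw [residueSum_X_pow]
    refine if_congr (natCast_zmod_eq_iff ?_ ?_) rfl rfl
    · exact (Finset.mem_range.1 hj).trans_le hbp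
    · omega
  simp only [middleCount, Fin.prod_univ_succ, Fin.sum_univ_succ, Fin.cons_zero,
    Finset.univ_eq_empty, Finset.prod_empty, Finset.sum_empty, mul_one, add_zero, Nat.cast_one,
    zero_add, e, Int.cast_natCast]
  rw [geomPoly, map_sum, Finset.sum_congr rfl h, Finset.sum_ite_eq', if_pos]
  rw [Finset.mem_range]
  omega

/-- The middle degree for `x + 2` is one above that for `x`, so the second count acquires a factor
`X` and `geomPoly_add_two` applies. This mirrors tensoring with a Jordan block of size two. -/
theorem middleCount_cons_add_two (p x : ℕ) (a : Fin s → ℕ) :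
    middleCount p (Fin.cons (x + 2) a : Fin (s + 1) → ℕ) +
        middleCount p (Fin.cons x a : Fin (s + 1) → ℕ) =
      residueSum p ((((∑ i, (a i : ℤ)) + x + 1 - s) / 2 : ℤ) : ZMod p)
        ((1 + X) * geomPoly (x + 1) * ∏ i, geomPoly (a i)) := by
  simp only [middleCount, Fin.prod_univ_succ, Fin.sum_univ_succ, Fin.cons_zero, Fin.cons_succ]
  push_cast
  have e1 : ((x : ℤ) + 2 + ∑ i, (a i : ℤ) - (s + 1)) / 2 =
      ((x : ℤ) + ∑ i, (a i : ℤ) - (s + 1)) / 2 + 1 := by omega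
  have e2 : ((∑ i, (a i : ℤ)) + x + 1 - s) / 2 =
      ((x : ℤ) + ∑ i, (a i : ℤ) - (s + 1)) / 2 + 1 := by omega
  rw [e1, e2, Int.cast_add, Int.cast_one, ← residueSum_X_mul p _ (geomPoly x * _), ← map_add,
    ← mul_assoc, ← add_mul, geomPoly_add_two]

/-- Both sides count with the product `(1 + X) * geomPoly (x + 1) * geomPoly (y + 1)`, which is
symmetric in `x` and `y`. -/
theorem middleCount_exchange (p x y : ℕ) (a : Fin s → ℕ) :
    middleCount p (Fin.cons (x + 2) (Fin.cons (y + 1) a : Fin (s + 1) → ℕ) : Fin (s + 2) → ℕ) +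
        middleCount p (Fin.cons x (Fin.cons (y + 1) a : Fin (s + 1) → ℕ) : Fin (s + 2) → ℕ) =
      middleCount p (Fin.cons (x + 1) (Fin.cons (y + 2) a : Fin (s + 1) → ℕ) : Fin (s + 2) → ℕ) +
        middleCount p (Fin.cons (x + 1) (Fin.cons y a : Fin (s + 1) → ℕ) : Fin (s + 2) → ℕ) := by
  rw [middleCount_cons_cons_swap p (x + 1), middleCount_cons_cons_swap p (x + 1),
    middleCount_cons_add_two, middleCount_cons_add_two]
  simp only [Fin.prod_univ_succ, Fin.sum_univ_succ, Fin.cons_zero, Fin.cons_succ]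
  push_cast
  congr 1
  · congr 4; ring
  · ring

end ResidueCount

/-! ### The exact colength for exponents at most `p` -/

section ExactFormula

variable {k : Type*} [Field k]

theorem linColength_cons_cons_cons_swap {s : ℕ} (x y z : ℕ) (a : Fin s → ℕ) :
    linColength k (Fin.cons z (Fin.cons x (Fin.cons y a : Fin (s + 1) → ℕ) : Fin (s + 2) → ℕ) :
        Fin (s + 3) → ℕ) =
      linColength k (Fin.cons z (Fin.cons y (Fin.cons x a : Fin (s + 1) → ℕ) : Fin (s + 2) → ℕ) :
        Fin (s + 3) → ℕ) := by
  rw [← linColength_comp_equiv (Equiv.swap (Fin.succ 0) (Fin.succ (Fin.succ 0)))]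
  congr 1
  ext i
  refine Fin.cases ?_ (fun i => Fin.cases ?_ (fun i => Fin.cases ?_ (fun i => ?_) i) i) i
  · rw [Function.comp_apply, Equiv.swap_apply_of_ne_of_ne (Fin.succ_ne_zero _).symm
      (Fin.succ_ne_zero _).symm]
    rfl
  · rw [Function.comp_apply, Equiv.swap_apply_left]
    rfl
  · rw [Function.comp_apply, Equiv.swap_apply_right]
    rfl
  · rw [Function.comp_apply, Equiv.swap_apply_of_ne_of_ne]
    · rfl
    · exact fun h => Fin.succ_ne_zero _ (Fin.succ_injective _ h)
    · exact fun h => Fin.succ_ne_zero _ (Fin.succ_injective _ (Fin.succ_injective _ h))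

/-- An extra Jordan block of size `2` may be absorbed into either of the blocks of sizes `x + 1` and
`y + 1`, neither size being divisible by `p`. -/
theorem linColength_exchange (p : ℕ) [CharP k p] {s : ℕ} (x y : ℕ) (hx : x + 1 < p) (hy : y + 1 < p)
    (a : Fin s → ℕ) :
    linColength k (Fin.cons (x + 2) (Fin.cons (y + 1) a : Fin (s + 1) → ℕ) : Fin (s + 2) → ℕ) +
        linColength k (Fin.cons x (Fin.cons (y + 1) a : Fin (s + 1) → ℕ) : Fin (s + 2) → ℕ) =
      linColength k (Fin.cons (x + 1) (Fin.cons (y + 2) a : Fin (s + 1) → ℕ) : Fin (s + 2) → ℕ) +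
        linColength k (Fin.cons (x + 1) (Fin.cons y a : Fin (s + 1) → ℕ) : Fin (s + 2) → ℕ) := by
  have hcast : ∀ n : ℕ, n + 1 < p → ((n + 1 : ℕ) : k) ≠ 0 := fun n hn h =>
    absurd (Nat.le_of_dvd n.succ_pos ((CharP.cast_eq_zero_iff k p _).1 h)) (by omega)
  rw [linColength_cons_cons_swap (x + 1), linColength_cons_cons_swap (x + 1),
    ← linColength_cons_two_cons x (hcast x hx), ← linColength_cons_two_cons y (hcast y hy),
    linColength_cons_cons_cons_swap]

theorem finrank_functions_fin_zero : finrank k ((Fin 0 → ℕ) → k) = 1 :=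
  (LinearEquiv.funUnique (Fin 0 → ℕ) k k).finrank_eq.trans (finrank_self k)

variable (p : ℕ) [Fact p.Prime] [CharP k p]

/-- The colength of the ideal generated by the `X i ^ a i` and `∑ X i` in characteristic `p`, when
`a i ≤ p`. -/
theorem linColength_eq_middleCount : ∀ {s : ℕ} (a : Fin s → ℕ), (∀ i, a i ≤ p) →
    (linColength k a : ℤ) = middleCount p a
  | 0, a, _ => by
    have h : boxKer k a 1 = ⊤ := by
      ext f
      simp [mem_boxKer, mem_box, totalShift]
    rw [linColength, h, finrank_top, finrank_functions_fin_zero]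
    simpa [middleCount] using (residueSum_X_pow p 0 0).symm
  | 1, a, ha => by
    rw [← Fin.cons_self_tail a]
    rcases Nat.eq_zero_or_pos (a 0) with h0 | h0
    · rw [h0, middleCount_cons_zero, linColength_cons_zero, Nat.cast_zero]
    · rw [middleCount_singleton p _ h0 (ha 0), linColength_cons]
      have h : boxKer k (Fin.tail a) (a 0) = ⊤ := by
        ext f
        simp [mem_boxKer, mem_box, totalShift, zero_pow h0.ne']
      rw [h, finrank_top, finrank_functions_fin_zero, Nat.cast_one]
  | s + 2, a, ha => by
    have hp : NeZero p := ⟨(Fact.out : p.Prime).ne_zero⟩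
    obtain ⟨x, b, r, rfl⟩ : ∃ (x b : ℕ) (r : Fin s → ℕ),
        a = (Fin.cons x (Fin.cons b r : Fin (s + 1) → ℕ) : Fin (s + 2) → ℕ) :=
      ⟨a 0, a 1, Fin.tail (Fin.tail a), by
        conv_lhs => rw [← Fin.cons_self_tail a, ← Fin.cons_self_tail (Fin.tail a)]
        rfl⟩
    have hr : ∀ i, r i ≤ p := fun i => by simpa using ha i.succ.succ
    have hx : x ≤ p := by simpa using ha 0
    have hb : b ≤ p := by simpa using ha (Fin.succ 0)
    clear ha
    have hcons : ∀ y, y ≤ p → ∀ i, (Fin.cons y r : Fin (s + 1) → ℕ) i ≤ p := fun y hy i => by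
      refine Fin.cases ?_ (fun i => ?_) i
      · simpa
      · simpa using hr i
    -- The exchange relation expresses the value at `(x + 2, b)` through first entries `x` and `x +
    -- 1`. It needs `0 < b < p`; at `b = 0` and `b = p` both sides are known, and first entry `1`
    -- removes a variable.
    induction x using Nat.strong_induction_on generalizing b with
    | _ x ih =>
      match x, hx, ih with
      | 0, _, _ => rw [linColength_cons_zero, middleCount_cons_zero, Nat.cast_zero]
      | 1, _, _ =>
        rw [linColength_cons_one, middleCount_cons_one]
        exact linColength_eq_middleCount _ (hcons b hb)
      | x + 2, hx, ih =>
        rcases Nat.eq_zero_or_pos b with rfl | hb0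
        · rw [linColength_cons_cons_swap, middleCount_cons_cons_swap, linColength_cons_zero,
            middleCount_cons_zero, Nat.cast_zero]
        rcases hb.eq_or_lt with rfl | hbp
        · rw [linColength_cons_cons_swap, middleCount_cons_cons_swap,
            linColength_cons_char _ _ (hcons _ hx), middleCount_cons_self, Nat.cast_prod]
        obtain ⟨y, rfl⟩ : ∃ y, b = y + 1 := ⟨b - 1, by omega⟩
        have h1 := linColength_exchange (k := k) p x y (by omega) (by omega) r
        have h2 := middleCount_exchange p x y r
        have h3 := ih x (by omega) (y + 1) (by omega) (by omega)
        have h4 := ih (x + 1) (by omega) (y + 2) (by omega) (by omega)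
        have h5 := ih (x + 1) (by omega) y (by omega) (by omega)
        omega

end ExactFormula

end DiagonalHK

namespace DiagonalHK

open Filter Topology

/-! ### Coefficients of products of geometric polynomials -/

section Coefficients

open Polynomial

/-- The coefficient of a polynomial in an integral degree, zero in negative degrees. -/
noncomputable def intCoeff (f : ℤ[X]) (n : ℤ) : ℤ := if 0 ≤ n then f.coeff n.toNat else 0

theorem residueSum_eq_sum_intCoeff (p : ℕ) [NeZero p] (f : ℤ[X]) (c : ℤ) (B : ℕ)
    (hf : ∀ m ∈ f.support, |(m : ℤ) - c| ≤ B * p) :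
    residueSum p (c : ZMod p) f = ∑ l ∈ Finset.Icc (-B : ℤ) B, intCoeff f (c + l * p) := by
  have hp : (0 : ℤ) < p := by exact_mod_cast Nat.pos_of_neZero p
  have h1 : residueSum p (c : ZMod p) f =
      ∑ m ∈ f.support, if (m : ZMod p) = c then f.coeff m else 0 := by
    rw [residueSum, lsum_apply, Polynomial.sum]
    refine Finset.sum_congr rfl fun m _ => ?_
    split_ifs <;> rfl
  have h2 : ∀ m ∈ f.support, (if (m : ZMod p) = c then f.coeff m else 0) =
      ∑ l ∈ Finset.Icc (-B : ℤ) B, if (m : ℤ) = c + l * p then f.coeff m else 0 := fun m hm => by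
    have hiff : (m : ZMod p) = c ↔ (p : ℤ) ∣ m - c := by
      rw [← ZMod.intCast_zmod_eq_zero_iff_dvd, Int.cast_sub, sub_eq_zero, Int.cast_natCast]
    split_ifs with h
    · obtain ⟨l, hl⟩ := hiff.1 h
      rw [Finset.sum_eq_single_of_mem l, if_pos (by linarith)]
      · have := hf m hm
        rw [hl, abs_mul, abs_of_pos hp, mul_comm] at this
        exact Finset.mem_Icc.2 (abs_le.1 (le_of_mul_le_mul_right this hp))
      · intro l' _ hne
        refine if_neg fun h' => hne ?_
        have : (p : ℤ) * l = p * l' := by rw [← hl, h']; ring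
        exact (mul_left_cancel₀ hp.ne' this).symm
    · refine (Finset.sum_eq_zero fun l _ => if_neg fun h' => h (hiff.2 ⟨l, ?_⟩)).symm
      rw [h']; ring
  rw [h1, Finset.sum_congr rfl h2, Finset.sum_comm]
  refine Finset.sum_congr rfl fun l _ => ?_
  rw [intCoeff]
  split_ifs with h
  · obtain ⟨n, hn⟩ := Int.eq_ofNat_of_zero_le h
    rw [hn]
    simp only [Nat.cast_inj, Int.toNat_natCast, Finset.sum_ite_eq', mem_support_iff]
    split_ifs with h'
    · rfl
    · exact (not_not.1 h').symm
  · exact Finset.sum_eq_zero fun m _ => if_neg fun h' => h (by omega)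

/-- The coefficient of `X ^ n` in `(1 - X) ^ (-(t + 1))`. -/
def simplexCount (t : ℕ) (n : ℤ) : ℤ := if 0 ≤ n then ((t + n.toNat).choose t : ℤ) else 0

/-- The product equals `∏ (1 - X ^ a i) * (1 - X) ^ (-(t + 1))` as a power series; `ε i = -1`
selects the term `-X ^ a i`. -/
theorem intCoeff_prod_geomPoly {t : ℕ} (a : Fin (t + 1) → ℕ) (n : ℤ) :
    intCoeff (∏ i, geomPoly (a i)) n = ∑ ε : Fin (t + 1) → ℤˣ,
      (∏ i, (ε i : ℤ)) * simplexCount t (n - ∑ i, if ε i = 1 then (0 : ℤ) else a i) := by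
  have hexp : (∏ i, (1 - X ^ a i) : ℤ[X]) = ∑ ε : Fin (t + 1) → ℤˣ,
      C (∏ i, (ε i : ℤ)) * X ^ (∑ i, if ε i = 1 then 0 else a i) := by
    have : ∀ i, (1 - X ^ a i : ℤ[X]) =
        ∑ e : ℤˣ, C (e : ℤ) * X ^ (if e = 1 then 0 else a i) := fun i => by
      rw [UnitsInt.univ, Finset.sum_pair (by decide)]
      simp [sub_eq_add_neg]
    simp_rw [this, Finset.prod_univ_sum, Fintype.piFinset_univ, Finset.prod_mul_distrib, map_prod,
      Finset.prod_pow_eq_pow_sum]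
  have hser : ((∏ i, geomPoly (a i) : ℤ[X]) : PowerSeries ℤ) =
      ((∏ i, (1 - X ^ a i) : ℤ[X]) : PowerSeries ℤ) *
        PowerSeries.mk fun n => ((t + n).choose t : ℤ) := by
    have h := PowerSeries.mk_add_choose_mul_one_sub_pow_eq_one ℤ t
    have h' : (∏ i, (1 - X ^ a i) : ℤ[X]) = (∏ i, geomPoly (a i)) * (1 - X) ^ (t + 1) := by
      simp_rw [← geomPoly_mul_one_sub, Finset.prod_mul_distrib]
      simp
    rw [h', Polynomial.coe_mul, Polynomial.coe_pow, Polynomial.coe_sub, Polynomial.coe_one,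
      Polynomial.coe_X, mul_assoc, mul_comm (_ ^ _), h, mul_one]
  have hnonneg : ∀ ε : Fin (t + 1) → ℤˣ,
      (∑ i, if ε i = 1 then (0 : ℤ) else a i) = ((∑ i, if ε i = 1 then 0 else a i : ℕ) : ℤ) :=
    fun ε => by push_cast; rfl
  rw [intCoeff]
  split_ifs with h
  · obtain ⟨m, rfl⟩ := Int.eq_ofNat_of_zero_le h
    rw [Int.toNat_natCast, ← Polynomial.coeff_coe, hser, hexp,
      ← Polynomial.coeToPowerSeries.ringHom_apply, map_sum, Finset.sum_mul, map_sum]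
    refine Finset.sum_congr rfl fun ε _ => ?_
    rw [Polynomial.coeToPowerSeries.ringHom_apply, Polynomial.coe_mul, Polynomial.coe_C,
      Polynomial.coe_pow, Polynomial.coe_X, mul_assoc,
      PowerSeries.coeff_C_mul, PowerSeries.coeff_X_pow_mul', hnonneg, simplexCount]
    congr 1
    split_ifs with h1 h2 h2
    · rw [PowerSeries.coeff_mk, ← Nat.cast_sub h1, Int.toNat_natCast]
    · omega
    · omega
    · rfl
  · refine (Finset.sum_eq_zero fun ε _ => ?_).symm
    rw [hnonneg, simplexCount, if_neg (by omega), mul_zero]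

end Coefficients

/-! ### Vanishing and symmetry of the sign sums -/

section SignSums

variable {s : ℕ}

/-- Each term of the expanded power has fewer than `s` factors, so it misses some index `i₀`;
flipping `ε i₀` changes only the sign of its contribution. -/
theorem sum_prod_sign_mul_pow_eq_zero (α : Fin s → ℝ) (c : ℝ) {m : ℕ} (hm : m < s) :
    -- In the expansion the constant `c` is treated as one further summand, indexed by `none`.
    ∑ ε : Fin s → ℤˣ, (∏ i, ((ε i : ℤ) : ℝ)) * ((∑ i, ((ε i : ℤ) : ℝ) * α i) + c) ^ m = 0 := by
  have hopt : ∀ ε : Fin s → ℤˣ, (∑ i, ((ε i : ℤ) : ℝ) * α i) + c =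
      ∑ o : Option (Fin s), o.elim c fun i => ((ε i : ℤ) : ℝ) * α i := fun ε => by
    rw [Fintype.sum_option, add_comm]; rfl
  simp_rw [hopt, Fintype.sum_pow, Finset.mul_sum]
  rw [Finset.sum_comm]
  refine Finset.sum_eq_zero fun g _ => ?_
  obtain ⟨i₀, hi₀⟩ : ∃ i₀ : Fin s, ∀ x, g x ≠ some i₀ := by
    by_contra! h
    choose x hx using h
    have : Function.Injective x := fun i j hij => by
      have := (hx i).symm.trans ((congrArg g hij).trans (hx j))
      exact Option.some_injective _ this
    have := Fintype.card_le_of_injective x this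
    simp at this
    omega
  let flip : (Fin s → ℤˣ) ≃ (Fin s → ℤˣ) := Equiv.mulRight (Pi.mulSingle i₀ (-1))
  have hflip : ∀ ε i, i ≠ i₀ → flip ε i = ε i := fun ε i h => by
    simp [flip, Pi.mulSingle_eq_of_ne h]
  have key := Equiv.sum_comp flip fun ε : Fin s → ℤˣ => (∏ i, ((ε i : ℤ) : ℝ)) *
    ∏ x, (g x).elim c fun i => ((ε i : ℤ) : ℝ) * α i
  have hneg : ∀ ε : Fin s → ℤˣ, (∏ i, ((flip ε i : ℤ) : ℝ)) = -∏ i, ((ε i : ℤ) : ℝ) := fun ε => by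
    have h1 : ∏ i, (Pi.mulSingle (M := fun _ => ℤˣ) i₀ (-1) i) = -1 := by
      simp [Finset.prod_pi_mulSingle']
    have h2 : ∏ i, flip ε i = -∏ i, ε i := by
      simp [flip, Finset.prod_mul_distrib, h1]
    have h3 := congrArg (fun u : ℤˣ => ((u : ℤ) : ℝ)) h2
    push_cast at h3
    simpa using h3
  have hsame : ∀ ε : Fin s → ℤˣ, (∏ x, (g x).elim c fun i => ((flip ε i : ℤ) : ℝ) * α i) =
      ∏ x, (g x).elim c fun i => ((ε i : ℤ) : ℝ) * α i := fun ε => by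
    refine Finset.prod_congr rfl fun x _ => ?_
    rcases hx : g x with _ | i
    · rfl
    · have : i ≠ i₀ := fun h => hi₀ x (by rw [hx, h])
      simp [hflip ε i this]
  simp only [hneg, hsame, neg_mul, Finset.sum_neg_distrib] at key
  linarith

theorem signSum_eq_sum_max {t : ℕ} (ht : 0 < t) (d : Fin (t + 1) → ℕ) (l : ℤ) :
    signSum d l = ∑ ε : Fin (t + 1) → ℤˣ, (∏ i, ((ε i : ℤ) : ℝ)) *
      (max ((∑ i, ((ε i : ℤ) : ℝ) / (d i : ℝ)) - 2 * (l : ℝ)) 0) ^ t := by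
  rw [signSum, Finset.sum_filter]
  refine Finset.sum_congr rfl fun ε _ => ?_
  split_ifs with h
  · rw [max_eq_left (by linarith), Nat.add_sub_cancel]
  · rw [max_eq_right (by linarith), zero_pow ht.ne', mul_zero]

theorem max_pow_add (y : ℝ) {t : ℕ} (ht : 0 < t) :
    y ^ t = max y 0 ^ t + (-1) ^ t * max (-y) 0 ^ t := by
  rcases le_total y 0 with h | h
  · rw [max_eq_right h, max_eq_left (by linarith), ← mul_pow, zero_pow ht.ne']
    simp
  · rw [max_eq_left h, max_eq_right (by linarith), zero_pow ht.ne']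
    simp

/-- The alternating sum of the full `t`-th powers vanishes, so positive and negative parts balance
up to `(-1) ^ t`; the substitution `ε ↦ -ε` exchanges them with sign `(-1) ^ (t + 1)`. -/
theorem signSum_neg {t : ℕ} (ht : 0 < t) (d : Fin (t + 1) → ℕ) (l : ℤ) :
    signSum d (-l) = signSum d l := by
  have h0 := sum_prod_sign_mul_pow_eq_zero (fun i => ((d i : ℝ))⁻¹) (-(2 * (l : ℝ)))
    (Nat.lt_succ_self t)
  simp only [← div_eq_mul_inv, ← sub_eq_add_neg] at h0
  rw [Finset.sum_congr rfl fun ε _ => by rw [max_pow_add _ ht, mul_add],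
    Finset.sum_add_distrib, ← signSum_eq_sum_max ht] at h0
  have h1 : signSum d (-l) = -∑ ε : Fin (t + 1) → ℤˣ, (∏ i, ((ε i : ℤ) : ℝ)) *
      ((-1) ^ t * (max (-((∑ i, ((ε i : ℤ) : ℝ) / (d i : ℝ)) - 2 * (l : ℝ))) 0) ^ t) := by
    rw [signSum_eq_sum_max ht, ← Equiv.sum_comp (Equiv.neg _), ← Finset.sum_neg_distrib]
    refine Finset.sum_congr rfl fun ε _ => ?_
    have e1 : (∏ i, (((Equiv.neg (Fin (t + 1) → ℤˣ)) ε i : ℤ) : ℝ)) =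
        (-1) ^ (t + 1) * ∏ i, ((ε i : ℤ) : ℝ) := by
      simp [Finset.prod_neg]
    have e2 : (∑ i, (((Equiv.neg (Fin (t + 1) → ℤˣ)) ε i : ℤ) : ℝ) / (d i : ℝ)) =
        -∑ i, ((ε i : ℤ) : ℝ) / (d i : ℝ) := by
      simp [neg_div, Finset.sum_neg_distrib]
    rw [e1, e2]
    push_cast
    rw [show -(∑ i, ((ε i : ℤ) : ℝ) / (d i : ℝ)) - 2 * -(l : ℝ) =
      -((∑ i, ((ε i : ℤ) : ℝ) / (d i : ℝ)) - 2 * (l : ℝ)) by ring]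
    ring
  linarith

theorem signSum_eq_zero_of_le {t : ℕ} (ht : 0 < t) (d : Fin (t + 1) → ℕ) (hd : ∀ i, 0 < d i) {l : ℤ}
    (hl : ((t + 1 : ℕ) : ℤ) < |l|) : signSum d l = 0 := by
  wlog h : 0 ≤ l generalizing l
  · rw [← signSum_neg ht]
    exact this (by rwa [abs_neg]) (by omega)
  rw [abs_of_nonneg h] at hl
  rw [signSum, Finset.filter_false_of_mem, Finset.sum_empty]
  intro ε _
  have h1 : ∑ i, ((ε i : ℤ) : ℝ) / (d i : ℝ) ≤ ∑ _i : Fin (t + 1), (1 : ℝ) := by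
    refine Finset.sum_le_sum fun i _ => ?_
    have hd1 : (1 : ℝ) ≤ d i := by exact_mod_cast hd i
    rw [div_le_one (by linarith)]
    rcases Int.units_eq_one_or (ε i) with h | h <;> rw [h] <;> push_cast <;> linarith
  have h2 : ((t + 1 : ℕ) : ℝ) < l := by exact_mod_cast hl
  have h3 : (0 : ℝ) ≤ l := by exact_mod_cast h
  simp at h1 h2
  linarith

theorem support_signSum_subset {t : ℕ} (ht : 0 < t) (d : Fin (t + 1) → ℕ) (hd : ∀ i, 0 < d i) :
    Function.support (signSum d) ⊆ Finset.Icc (-(t + 1 : ℕ) : ℤ) (t + 1 : ℕ) := by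
  intro l hl
  rw [Finset.coe_Icc, Set.mem_Icc, ← abs_le]
  by_contra h
  exact hl (signSum_eq_zero_of_le ht d hd (not_le.1 h))

theorem finsum_signSum_eq {t : ℕ} (ht : 0 < t) (d : Fin (t + 1) → ℕ) (hd : ∀ i, 0 < d i) :
    ∑ᶠ l : ℤ, signSum d l = signSum d 0 + 2 * ∑ᶠ (l : ℤ) (_ : 0 < l), signSum d l := by
  have hfin : (Function.support (signSum d)).Finite :=
    (Finset.finite_toSet _).subset (support_signSum_subset ht d hd)
  have h1 : ∑ᶠ l : ℤ, signSum d l = ∑ᶠ l ∈ (Set.univ : Set ℤ), signSum d l := by simp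
  have h2 : (Set.univ : Set ℤ) = {0} ∪ (Set.Ioi 0 ∪ Set.Iio 0) := by
    ext l; simp
  have hIio : ∑ᶠ l ∈ Set.Iio (0 : ℤ), signSum d l = ∑ᶠ l ∈ Set.Ioi (0 : ℤ), signSum d l := by
    have e : Set.Iio (0 : ℤ) = (fun l => -l) '' Set.Ioi (0 : ℤ) := by simp
    rw [e, finsum_mem_image (neg_injective.injOn)]
    simp_rw [signSum_neg ht]
  rw [h1, h2, finsum_mem_union' _ (hfin.subset Set.inter_subset_right)
    (hfin.subset Set.inter_subset_right), finsum_mem_union' _ (hfin.subset Set.inter_subset_right)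
    (hfin.subset Set.inter_subset_right), hIio, finsum_mem_singleton]
  · simp only [Set.mem_Ioi]; ring
  · rw [Set.disjoint_left]; intro x hx; simp at hx ⊢; omega
  · rw [Set.disjoint_left]; intro x hx; simp at hx ⊢; omega

end SignSums

/-! ### Asymptotics of the middle count -/

section Limit

theorem tendsto_div_of_abs_sub_le {u : ℕ → ℝ} {α C : ℝ} (h : ∀ n : ℕ, |u n - α * n| ≤ C) :
    Tendsto (fun n : ℕ => u n / n) atTop (𝓝 α) := by
  have h1 : Tendsto (fun n : ℕ => C / (n : ℝ)) atTop (𝓝 0) :=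
    tendsto_const_div_atTop_nhds_zero_nat C
  rw [tendsto_iff_dist_tendsto_zero]
  refine squeeze_zero' (Eventually.of_forall fun _ => dist_nonneg) ?_ h1
  filter_upwards [eventually_gt_atTop 0] with n hn
  have hn' : (0 : ℝ) < n := by exact_mod_cast hn
  rw [Real.dist_eq, show u n / n - α = (u n - α * n) / n by field_simp, abs_div, abs_of_pos hn']
  gcongr
  exact h n

theorem abs_natDiv_sub_le (n d : ℕ) (hd : 0 < d) : |((n / d : ℕ) : ℝ) - (d : ℝ)⁻¹ * n| ≤ 1 := by
  have hd' : (0 : ℝ) < d := by exact_mod_cast hd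
  have h1 : ((n / d : ℕ) : ℝ) ≤ n / d := Nat.cast_div_le
  have h2 : (n : ℝ) / d < (n / d : ℕ) + 1 := by
    rw [div_lt_iff₀ hd']
    exact_mod_cast Nat.lt_mul_of_div_lt (Nat.lt_succ_self _) hd
  rw [inv_mul_eq_div, abs_le]
  constructor <;> linarith

/-- For `n ≥ 0`, `t!` times the binomial coefficient is `(n + 1) ⋯ (n + t)`; for `n < 0` the count
is `0`, as is the positive part of `n`. -/
theorem simplexCount_bounds (t : ℕ) (ht : 0 < t) (n : ℤ) :
    (max (n : ℝ) 0) ^ t / t.factorial ≤ simplexCount t n ∧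
      (simplexCount t n : ℝ) ≤ (max (n : ℝ) 0 + t) ^ t / t.factorial := by
  have hf : (0 : ℝ) < t.factorial := by exact_mod_cast t.factorial_pos
  rw [simplexCount]
  split_ifs with h
  · obtain ⟨m, rfl⟩ := Int.eq_ofNat_of_zero_le h
    have h1 := Nat.ascFactorial_eq_factorial_mul_choose m t
    have h2 : m ^ t ≤ (m + 1).ascFactorial t :=
      (Nat.pow_le_pow_left m.le_succ t).trans (Nat.pow_succ_le_ascFactorial _ _)
    have h3 := Nat.ascFactorial_le_pow_add m t
    rw [h1, add_comm m t] at h2 h3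
    have h2' : ((m : ℝ)) ^ t ≤ t.factorial * (t + m).choose t := by exact_mod_cast h2
    have h3' : (t.factorial * (t + m).choose t : ℝ) ≤ (t + m) ^ t := by exact_mod_cast h3
    simp only [Int.toNat_natCast, Int.cast_natCast]
    rw [max_eq_left (Nat.cast_nonneg m), div_le_iff₀ hf, le_div_iff₀ hf, add_comm (m : ℝ)]
    constructor <;> linarith
  · have hn : (n : ℝ) ≤ 0 := by exact_mod_cast (not_le.1 h).le
    rw [max_eq_right hn, zero_pow ht.ne', zero_div, Int.cast_zero]
    exact ⟨le_rfl, by positivity⟩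

theorem tendsto_simplexCount {t : ℕ} (ht : 0 < t) {u : ℕ → ℤ} {x : ℝ}
    (hu : Tendsto (fun n : ℕ => (u n : ℝ) / n) atTop (𝓝 x)) :
    Tendsto (fun n : ℕ => (simplexCount t (u n) : ℝ) / (n : ℝ) ^ t) atTop
      (𝓝 (max x 0 ^ t / t.factorial)) := by
  have h0 : Tendsto (fun n : ℕ => max ((u n : ℝ) / n) 0) atTop (𝓝 (max x 0)) :=
    hu.max tendsto_const_nhds
  have h1 : Tendsto (fun n : ℕ => (max ((u n : ℝ) / n) 0) ^ t / t.factorial) atTop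
      (𝓝 (max x 0 ^ t / t.factorial)) := (h0.pow t).div_const _
  have h2 : Tendsto (fun n : ℕ => (max ((u n : ℝ) / n) 0 + t / n) ^ t / t.factorial) atTop
      (𝓝 (max x 0 ^ t / t.factorial)) := by
    have := h0.add (tendsto_const_div_atTop_nhds_zero_nat (t : ℝ))
    rw [add_zero] at this
    exact (this.pow t).div_const _
  have hmax : ∀ n : ℕ, 0 < n → max ((u n : ℝ) / n) 0 = max (u n : ℝ) 0 / n := fun n hn => by
    rw [← max_div_div_right (Nat.cast_nonneg n), zero_div]
  refine tendsto_of_tendsto_of_tendsto_of_le_of_le' h1 h2 ?_ ?_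
  · filter_upwards [eventually_gt_atTop 0] with n hn
    have hn' : (0 : ℝ) < n := by exact_mod_cast hn
    rw [hmax n hn, div_pow, div_right_comm]
    gcongr
    exact (simplexCount_bounds t ht (u n)).1
  · filter_upwards [eventually_gt_atTop 0] with n hn
    have hn' : (0 : ℝ) < n := by exact_mod_cast hn
    rw [hmax n hn, ← add_div, div_pow, div_right_comm]
    gcongr
    exact (simplexCount_bounds t ht (u n)).2

theorem middleCount_div_eq {t : ℕ} (d : Fin (t + 1) → ℕ) {p : ℕ} (hp : 2 ≤ p) :
    middleCount p (fun i => p / d i) =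
      ∑ l ∈ Finset.Icc (-(t + 1 : ℕ) : ℤ) (t + 1 : ℕ), ∑ ε : Fin (t + 1) → ℤˣ,
        (∏ i, (ε i : ℤ)) * simplexCount t (((∑ i, ((p / d i : ℕ) : ℤ)) - (t + 1 : ℕ)) / 2 + l * p -
          ∑ i, if ε i = 1 then (0 : ℤ) else (p / d i : ℕ)) := by
  have : NeZero p := ⟨by omega⟩
  rw [middleCount, residueSum_eq_sum_intCoeff p _ _ (t + 1)]
  · simp_rw [intCoeff_prod_geomPoly]
  · intro m hm
    have h1 : m ≤ ∑ i, p / d i := by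
      refine (Polynomial.le_natDegree_of_mem_supp m hm).trans
        ((Polynomial.natDegree_prod_le _ _).trans (Finset.sum_le_sum fun i _ => ?_))
      refine Polynomial.natDegree_sum_le_of_forall_le _ _ fun j hj => ?_
      rw [Polynomial.natDegree_X_pow]
      exact (Finset.mem_range.1 hj).le
    have h2 : ∑ i, p / d i ≤ (t + 1) * p := by
      refine (Finset.sum_le_sum fun i _ => Nat.div_le_self p (d i)).trans ?_
      simp
    have h3 : 2 * (t + 1) ≤ (t + 1) * p := by rw [mul_comm]; gcongr
    have h1' : (m : ℤ) ≤ ∑ i, ((p / d i : ℕ) : ℤ) := by exact_mod_cast h1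
    have h2' : ∑ i, ((p / d i : ℕ) : ℤ) ≤ ((t + 1 : ℕ) : ℤ) * p := by exact_mod_cast h2
    have h3' : 2 * ((t + 1 : ℕ) : ℤ) ≤ ((t + 1 : ℕ) : ℤ) * p := by exact_mod_cast h3
    rw [abs_le]
    generalize ((t + 1 : ℕ) : ℤ) * p = N at *
    generalize ∑ i, ((p / d i : ℕ) : ℤ) = S at *
    omega

theorem tendsto_middleCount {t : ℕ} (ht : 0 < t) (d : Fin (t + 1) → ℕ) (hd : ∀ i, 0 < d i) :
    Tendsto (fun p : ℕ => (middleCount p (fun i => p / d i) : ℝ) / (p : ℝ) ^ t) atTop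
      (𝓝 ((2 : ℝ) ^ (1 - ((t + 1 : ℕ) : ℤ)) / t.factorial * ∑ᶠ l : ℤ, signSum d l)) := by
  set S : Finset ℤ := Finset.Icc (-(t + 1 : ℕ) : ℤ) (t + 1 : ℕ) with hS
  have hlim : (2 : ℝ) ^ (1 - ((t + 1 : ℕ) : ℤ)) / t.factorial * ∑ᶠ l : ℤ, signSum d l =
      ∑ l ∈ S, ∑ ε : Fin (t + 1) → ℤˣ, (∏ i, ((ε i : ℤ) : ℝ)) *
        (max ((∑ i, ((ε i : ℤ) : ℝ) / (d i : ℝ)) / 2 + l) 0 ^ t / t.factorial) := by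
    rw [finsum_eq_sum_of_support_subset _ (support_signSum_subset ht d hd), Finset.mul_sum]
    refine Finset.sum_congr rfl fun l _ => ?_
    -- The coefficient in degree `middle + l * p` yields the shift `+ l`, hence `signSum d (-l)`;
    -- halving the argument accounts for the factor `2 ^ (-t)`.
    rw [← signSum_neg ht, signSum_eq_sum_max ht, Finset.mul_sum]
    refine Finset.sum_congr rfl fun ε _ => ?_
    have e : max ((∑ i, ((ε i : ℤ) : ℝ) / (d i : ℝ)) / 2 + l) 0 =
        max ((∑ i, ((ε i : ℤ) : ℝ) / (d i : ℝ)) - 2 * ((-l : ℤ) : ℝ)) 0 / 2 := by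
      rw [← max_div_div_right zero_le_two, zero_div]
      congr 1
      push_cast
      ring
    rw [e, div_pow, show (1 : ℤ) - ((t + 1 : ℕ) : ℤ) = -(t : ℤ) by push_cast; ring, zpow_neg,
      zpow_natCast]
    field_simp
  rw [hlim]
  have hmain : Tendsto (fun p : ℕ => ∑ l ∈ S, ∑ ε : Fin (t + 1) → ℤˣ, (∏ i, ((ε i : ℤ) : ℝ)) *
      ((simplexCount t (((∑ i, ((p / d i : ℕ) : ℤ)) - (t + 1 : ℕ)) / 2 + l * p -
          ∑ i, if ε i = 1 then (0 : ℤ) else (p / d i : ℕ)) : ℝ) / (p : ℝ) ^ t)) atTop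
      (𝓝 (∑ l ∈ S, ∑ ε : Fin (t + 1) → ℤˣ, (∏ i, ((ε i : ℤ) : ℝ)) *
        (max ((∑ i, ((ε i : ℤ) : ℝ) / (d i : ℝ)) / 2 + l) 0 ^ t / t.factorial))) := by
    refine tendsto_finsetSum _ fun l _ => tendsto_finsetSum _ fun ε _ =>
      (tendsto_simplexCount ht ?_).const_mul _
    have hdiv : ∀ i, Tendsto (fun p : ℕ => ((p / d i : ℕ) : ℝ) / p) atTop (𝓝 (d i : ℝ)⁻¹) :=
      fun i => tendsto_div_of_abs_sub_le fun n => abs_natDiv_sub_le n (d i) (hd i)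
    have hrem : Tendsto (fun p : ℕ => (((((∑ i, ((p / d i : ℕ) : ℤ)) - (t + 1 : ℕ)) / 2 : ℤ) : ℝ) -
        (∑ i, ((p / d i : ℕ) : ℝ)) / 2) / p) atTop (𝓝 0) := by
      refine tendsto_div_of_abs_sub_le (C := t + 2) fun p => ?_
      rw [zero_mul, sub_zero, show ∑ i, ((p / d i : ℕ) : ℝ) = ((∑ i, ((p / d i : ℕ) : ℤ) : ℤ) : ℝ) by
        push_cast; rfl]
      generalize ∑ i, ((p / d i : ℕ) : ℤ) = A
      have h1 : 2 * ((A - (t + 1 : ℕ)) / 2) ≤ A := by omega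
      have h2 : A ≤ 2 * ((A - (t + 1 : ℕ)) / 2) + t + 2 := by omega
      have h1' : 2 * (((A - (t + 1 : ℕ)) / 2 : ℤ) : ℝ) ≤ A := by exact_mod_cast h1
      have h2' : (A : ℝ) ≤ 2 * (((A - (t + 1 : ℕ)) / 2 : ℤ) : ℝ) + t + 2 := by exact_mod_cast h2
      rw [abs_le]
      constructor <;> linarith
    have hhalf := (tendsto_finsetSum Finset.univ fun i _ => hdiv i).div_const 2
    have hsub : Tendsto (fun p : ℕ => ∑ i, if ε i = 1 then (0 : ℝ) else ((p / d i : ℕ) : ℝ) / p) atTop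
        (𝓝 (∑ i, if ε i = 1 then (0 : ℝ) else (d i : ℝ)⁻¹)) :=
      tendsto_finsetSum _ fun i _ => by
        split_ifs
        · exact tendsto_const_nhds
        · exact hdiv i
    have hall := ((hrem.add hhalf).add_const (l : ℝ)).sub hsub
    have hval : 0 + (∑ i, (d i : ℝ)⁻¹) / 2 + l - (∑ i, if ε i = 1 then (0 : ℝ) else (d i : ℝ)⁻¹) =
        (∑ i, ((ε i : ℤ) : ℝ) / (d i : ℝ)) / 2 + l := by
      have : ∀ i, ((ε i : ℤ) : ℝ) / (d i : ℝ) =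
          (d i : ℝ)⁻¹ - 2 * if ε i = 1 then (0 : ℝ) else (d i : ℝ)⁻¹ := fun i => by
        rcases Int.units_eq_one_or (ε i) with h | h
        · simp [h]
        · rw [h, if_neg (by decide)]; push_cast; ring
      simp_rw [this, Finset.sum_sub_distrib, ← Finset.mul_sum]
      ring
    rw [hval] at hall
    refine hall.congr' ?_
    filter_upwards [eventually_gt_atTop 0] with p hp
    have hp' : (p : ℝ) ≠ 0 := by positivity
    have e1 : (∑ i, if ε i = 1 then (0 : ℝ) else ((p / d i : ℕ) : ℝ) / p) =
        (∑ i, if ε i = 1 then (0 : ℝ) else ((p / d i : ℕ) : ℝ)) / p := by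
      rw [Finset.sum_div]
      exact Finset.sum_congr rfl fun i _ => by split_ifs <;> simp
    rw [e1, ← Finset.sum_div, Int.cast_sub, Int.cast_add, Int.cast_mul, Int.cast_sum,
      Int.cast_natCast, Finset.sum_congr rfl fun i _ => Int.cast_ite (R := ℝ) (ε i = 1) 0 _]
    simp only [Int.cast_zero, Int.cast_natCast]
    field_simp
    ring
  refine hmain.congr' ?_
  filter_upwards [eventually_ge_atTop 2] with p hp
  rw [middleCount_div_eq d hp]
  push_cast
  rw [Finset.sum_div]
  refine Finset.sum_congr rfl fun l _ => ?_
  rw [Finset.sum_div]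
  refine Finset.sum_congr rfl fun ε _ => ?_
  rw [mul_div_assoc]

end Limit

end DiagonalHK

namespace DiagonalHK

open Filter Topology

/-! ### Existence, approximation and uniqueness of the multiplicity -/

section Multiplicity

variable {t : ℕ} (p : ℕ) [hp : Fact p.Prime] (d : Fin (t + 2) → ℕ)

/-- The colength `linColength` for the exponents `⌊p ^ n / d i⌋`. -/
noncomputable def floorColength (n : ℕ) : ℕ := linColength (ZMod p) fun i => p ^ n / d i

variable {d}

/-- Multiplying the exponents by `p` is exact, and `⌊p ^ (n + 1) / d i⌋` exceeds `p * ⌊p ^ n / d i⌋`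
by at most `p`; the Lipschitz bound absorbs the difference. -/
theorem floorColength_succ (hd : ∀ i, 0 < d i) (n : ℕ) :
    p ^ (t + 1) * floorColength p d n ≤ floorColength p d (n + 1) ∧
      floorColength p d (n + 1) ≤
        p ^ (t + 1) * floorColength p d n + (t + 2) * p * (p ^ (n + 1)) ^ t := by
  have hle : (fun i => p * (p ^ n / d i)) ≤ fun i => p ^ (n + 1) / d i := fun i => by
    simp only [pow_succ']
    exact Nat.mul_div_le_mul_div_assoc _ _ _
  have hsub : ∀ i, p ^ (n + 1) / d i - p * (p ^ n / d i) ≤ p := fun i => by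
    rw [tsub_le_iff_right, ← Nat.lt_succ_iff, Nat.div_lt_iff_lt_mul (hd i), pow_succ']
    have h1 := Nat.lt_mul_of_div_lt (Nat.lt_succ_self (p ^ n / d i)) (hd i)
    have h2 := Nat.mul_lt_mul_of_pos_left h1 hp.out.pos
    have h3 := hd i
    rw [Nat.succ_eq_add_one] at h2 ⊢
    nlinarith
  have h := linColength_mono_lipschitz (k := ZMod p) hle fun i => Nat.div_le_self _ (d i)
  rw [linColength_char_mul] at h
  refine ⟨h.1, h.2.trans ?_⟩
  have hs : ∑ i, (p ^ (n + 1) / d i - p * (p ^ n / d i)) ≤ (t + 2) * p := by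
    refine (Finset.sum_le_sum fun i _ => hsub i).trans ?_
    simp
  exact Nat.add_le_add_left (Nat.mul_le_mul_right _ hs) _

theorem linColength_residueBox (n : ℕ) (r : ∀ i, Fin (d i)) :
    floorColength p d n ≤ linColength (ZMod p) (residueBox d (fun _ => p ^ n) r) ∧
      linColength (ZMod p) (residueBox d (fun _ => p ^ n) r) ≤
        floorColength p d n + (t + 2) * (p ^ n) ^ t := by
  have hq : 0 < p ^ n := pow_pos hp.out.pos n
  have hd : ∀ i, 0 < d i := fun i => (Nat.zero_le _).trans_lt (r i).2
  have hle : (fun i => p ^ n / d i) ≤ residueBox d (fun _ => p ^ n) r := fun i => by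
    have := (r i).2
    refine Nat.div_le_div_right ?_
    simp only
    omega
  have hsub : ∀ i, residueBox d (fun _ => p ^ n) r i - p ^ n / d i ≤ 1 := fun i => by
    rw [tsub_le_iff_left, residueBox_le_iff]
    have h1 := Nat.lt_mul_of_div_lt (Nat.lt_succ_self (p ^ n / d i)) (hd i)
    rw [mul_comm] at h1
    exact h1.le.trans (Nat.le_add_left _ _)
  have hN : ∀ i, residueBox d (fun _ => p ^ n) r i ≤ p ^ n := fun i => by
    rw [residueBox_le_iff]
    exact (Nat.le_mul_of_pos_left _ (hd i)).trans (Nat.le_add_left _ _)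
  have h := linColength_mono_lipschitz (k := ZMod p) hle hN
  refine ⟨h.1, h.2.trans (Nat.add_le_add_left (Nat.mul_le_mul_right _ ?_) _)⟩
  refine (Finset.sum_le_sum fun i _ => hsub i).trans ?_
  simp

/-- The sum of the colengths of the residue boxes, which is the Hilbert-Kunz function. -/
theorem sum_linColength_residueBox (n : ℕ) :
    |((∑ r : (∀ i, Fin (d i)), linColength (ZMod p) (residueBox d (fun _ => p ^ n) r) : ℕ) : ℝ) -
      (∏ i, d i : ℕ) * floorColength p d n| ≤ (∏ i, d i : ℕ) * ((t + 2) * ((p : ℝ) ^ n) ^ t) := by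
  have hcard : (∏ i, d i : ℕ) = Fintype.card (∀ i, Fin (d i)) := by simp
  have h1 : (∏ i, d i : ℕ) * floorColength p d n ≤
      ∑ r : (∀ i, Fin (d i)), linColength (ZMod p) (residueBox d (fun _ => p ^ n) r) := by
    rw [hcard, ← smul_eq_mul]
    exact Finset.card_nsmul_le_sum _ _ _ fun r _ => (linColength_residueBox p n r).1
  have h2 : ∑ r : (∀ i, Fin (d i)), linColength (ZMod p) (residueBox d (fun _ => p ^ n) r) ≤
      (∏ i, d i : ℕ) * (floorColength p d n + (t + 2) * (p ^ n) ^ t) := by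
    rw [hcard, ← smul_eq_mul]
    exact Finset.sum_le_card_nsmul _ _ _ fun r _ => (linColength_residueBox p n r).2
  generalize ∑ r : (∀ i, Fin (d i)), linColength (ZMod p) (residueBox d (fun _ => p ^ n) r) = E at *
  have h1' : ((∏ i, d i : ℕ) : ℝ) * floorColength p d n ≤ E := by exact_mod_cast h1
  have h2' : (E : ℝ) ≤ ((∏ i, d i : ℕ) : ℝ) * (floorColength p d n + (t + 2) * ((p : ℝ) ^ n) ^ t) := by
    exact_mod_cast h2
  rw [abs_of_nonneg (by linarith)]
  linarith

theorem floorColength_lower_bound (hd : ∀ i, 0 < d i) (n : ℕ) (hn : ∀ i, d i ≤ p ^ n) :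
    ((p : ℝ) ^ n) ^ (t + 1) / ((t + 2) * ∏ i, (2 * (d i : ℝ))) ≤ floorColength p d n := by
  have hq : (0 : ℝ) < (p : ℝ) ^ n := pow_pos (by exact_mod_cast hp.out.pos) n
  have h := prod_le_sum_mul_linColength (k := ZMod p) fun i => p ^ n / d i
  have h' : ∏ i, ((p ^ n / d i : ℕ) : ℝ) ≤ (∑ i, ((p ^ n / d i : ℕ) : ℝ)) * floorColength p d n := by
    exact_mod_cast h
  have hfac : ∀ i, (p : ℝ) ^ n / (2 * d i) ≤ ((p ^ n / d i : ℕ) : ℝ) := fun i => by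
    have hdi : (0 : ℝ) < d i := by exact_mod_cast hd i
    have h1 := Nat.lt_mul_of_div_lt (Nat.lt_succ_self (p ^ n / d i)) (hd i)
    have h2 : 1 ≤ p ^ n / d i := (Nat.one_le_div_iff (hd i)).2 (hn i)
    have h3 : p ^ n ≤ (p ^ n / d i) * (2 * d i) := by
      nlinarith [Nat.mul_le_mul_right (d i) h2]
    rw [div_le_iff₀ (by positivity)]
    exact_mod_cast h3
  have hprod : ((p : ℝ) ^ n) ^ (t + 2) / ∏ i, (2 * (d i : ℝ)) ≤ ∏ i, ((p ^ n / d i : ℕ) : ℝ) := by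
    have : ((p : ℝ) ^ n) ^ (t + 2) / ∏ i, (2 * (d i : ℝ)) = ∏ i, (p : ℝ) ^ n / (2 * d i) := by
      rw [Finset.prod_div_distrib]; simp
    rw [this]
    exact Finset.prod_le_prod (fun i _ => by positivity) fun i _ => hfac i
  have hsum : ∑ i, ((p ^ n / d i : ℕ) : ℝ) ≤ (t + 2) * (p : ℝ) ^ n := by
    have : ∀ i ∈ Finset.univ, ((p ^ n / d i : ℕ) : ℝ) ≤ (p : ℝ) ^ n := fun i _ => by
      exact_mod_cast Nat.div_le_self _ (d i)
    refine (Finset.sum_le_sum this).trans ?_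
    simp
  have hP : 0 < ∏ i, (2 * (d i : ℝ)) := Finset.prod_pos fun i _ => by
    have : (0 : ℝ) < d i := by exact_mod_cast hd i
    positivity
  have hfinal : ((p : ℝ) ^ n) ^ (t + 2) / ∏ i, (2 * (d i : ℝ)) ≤
      ((t + 2) * (p : ℝ) ^ n) * floorColength p d n :=
    hprod.trans (h'.trans (by gcongr))
  rw [div_le_iff₀ (by positivity)]
  rw [div_le_iff₀ hP] at hfinal
  refine le_of_mul_le_mul_right ?_ hq
  calc _ = ((p : ℝ) ^ n) ^ (t + 2) := by ring
    _ ≤ _ := hfinal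
    _ = _ := by ring

/-- The normalized colengths move by at most `(t + 2) / p ^ n` at step `n`, so they converge
geometrically. The constant `2 * (t + 2)` does not depend on `p`, which is essential for the limit
over primes. -/
theorem exists_limit_floorColength (hd : ∀ i, 0 < d i) :
    ∃ y : ℝ, 0 < y ∧ ∀ n, |(floorColength p d n : ℝ) - y * ((p : ℝ) ^ n) ^ (t + 1)| ≤
      2 * (t + 2) * ((p : ℝ) ^ n) ^ t := by
  have hp2 : (2 : ℝ) ≤ p := by exact_mod_cast hp.out.two_le
  have hp0 : (0 : ℝ) < p := by linarith
  set y : ℕ → ℝ := fun n => floorColength p d n / ((p : ℝ) ^ n) ^ (t + 1) with hy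
  have hr : (p : ℝ)⁻¹ ≤ 1 / 2 := by rw [one_div]; exact inv_anti₀ two_pos hp2
  have hr1 : (p : ℝ)⁻¹ < 1 := by linarith
  have hdist : ∀ n, dist (y n) (y (n + 1)) ≤ (t + 2) * (p : ℝ)⁻¹ ^ n := fun n => by
    have hq : (0 : ℝ) < (p : ℝ) ^ n := by positivity
    have h := floorColength_succ p hd n
    have h1 : (p : ℝ) ^ (t + 1) * floorColength p d n ≤ floorColength p d (n + 1) := by
      exact_mod_cast h.1
    have h2 : (floorColength p d (n + 1) : ℝ) ≤
        (p : ℝ) ^ (t + 1) * floorColength p d n + (t + 2) * p * ((p : ℝ) ^ (n + 1)) ^ t := by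
      exact_mod_cast h.2
    have e : y (n + 1) - y n =
        (floorColength p d (n + 1) - (p : ℝ) ^ (t + 1) * floorColength p d n) /
          ((p : ℝ) ^ (n + 1)) ^ (t + 1) := by
      simp only [hy]
      rw [pow_succ (p : ℝ) n, mul_pow]
      field_simp
    rw [dist_comm, Real.dist_eq, e, abs_of_nonneg (div_nonneg (by linarith) (by positivity)),
      div_le_iff₀ (by positivity)]
    have e2 : (t + 2) * (p : ℝ)⁻¹ ^ n * ((p : ℝ) ^ (n + 1)) ^ (t + 1) =
        (t + 2) * p * ((p : ℝ) ^ (n + 1)) ^ t := by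
      rw [pow_succ ((p : ℝ) ^ (n + 1)), pow_succ (p : ℝ) n, inv_pow]
      field_simp
    rw [e2]
    linarith
  obtain ⟨Y, hY⟩ := cauchySeq_tendsto_of_complete (cauchySeq_of_le_geometric _ _ hr1 hdist)
  refine ⟨Y, ?_, fun n => ?_⟩
  · have hP : 0 < ∏ i, (2 * (d i : ℝ)) := Finset.prod_pos fun i _ => by
      have : (0 : ℝ) < d i := by exact_mod_cast hd i
      positivity
    have hc : 0 < 1 / ((t + 2) * ∏ i, (2 * (d i : ℝ))) := by positivity
    refine hc.trans_le (ge_of_tendsto hY ?_)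
    filter_upwards [eventually_ge_atTop (∑ i, d i)] with n hn
    have hq : (0 : ℝ) < (p : ℝ) ^ n := by positivity
    have h := floorColength_lower_bound p hd n fun i =>
      ((Finset.single_le_sum (fun _ _ => Nat.zero_le _) (Finset.mem_univ i)).trans hn).trans
        (Nat.lt_pow_self hp.out.one_lt).le
    rw [hy, le_div_iff₀ (by positivity), one_div_mul_eq_div]
    exact h
  · have hq : (0 : ℝ) < (p : ℝ) ^ n := by positivity
    have h := dist_le_of_le_geometric_of_tendsto _ _ hr1 hdist hY n
    -- The factor `2` bounds `1 / (1 - 1 / p)`, as `p ≥ 2`.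
    have hb : (t + 2) * (p : ℝ)⁻¹ ^ n / (1 - (p : ℝ)⁻¹) ≤ 2 * (t + 2) * (p : ℝ)⁻¹ ^ n := by
      rw [div_le_iff₀ (by linarith)]
      have : 0 ≤ (t + 2) * (p : ℝ)⁻¹ ^ n := by positivity
      nlinarith
    have h' := h.trans hb
    rw [Real.dist_eq] at h'
    have e : (floorColength p d n : ℝ) - Y * ((p : ℝ) ^ n) ^ (t + 1) =
        (y n - Y) * ((p : ℝ) ^ n) ^ (t + 1) := by
      simp only [hy]
      field_simp
    rw [e, abs_mul, abs_of_pos (show (0 : ℝ) < ((p : ℝ) ^ n) ^ (t + 1) by positivity)]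
    refine (mul_le_mul_of_nonneg_right h' (by positivity)).trans_eq ?_
    rw [pow_succ ((p : ℝ) ^ n), inv_pow]
    field_simp

/-- The approximation is the estimate at `n = 1`, where every exponent `⌊p / d i⌋` is at most `p`
and the exact formula applies. -/
theorem exists_isHilbertKunzMultiplicity (hd : ∀ i, 0 < d i) :
    ∃ m : ℝ, IsHilbertKunzMultiplicity (diagonalForm p d) m ∧
      |m - (∏ i, d i : ℕ) * (floorColength p d 1 / (p : ℝ) ^ (t + 1))| ≤
        (∏ i, d i : ℕ) * (2 * (t + 2)) / p := by
  obtain ⟨y, hy0, hy⟩ := exists_limit_floorColength p hd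
  have hp0 : (0 : ℝ) < p := by exact_mod_cast hp.out.pos
  have hD : (0 : ℝ) < (∏ i, d i : ℕ) := by exact_mod_cast Finset.prod_pos fun i _ => hd i
  set D : ℝ := ((∏ i, d i : ℕ) : ℝ) with hDdef
  refine ⟨D * y, ⟨mul_pos hD hy0, _, fun n => hkColength_diagonalForm p d hd n, ?_⟩, ?_⟩
  -- One `t + 2` comes from replacing the residue boxes by floors, two from the distance to the
  -- limit.
  · refine Asymptotics.IsBigO.of_bound (D * (3 * (t + 2))) (Eventually.of_forall fun n => ?_)
    have h1 := sum_linColength_residueBox p (d := d) n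
    have h2 := mul_le_mul_of_nonneg_left (hy n) hD.le
    rw [← hDdef] at h1
    rw [← abs_of_pos hD, ← abs_mul, abs_of_pos hD] at h2
    rw [Real.norm_eq_abs, Real.norm_eq_abs, abs_of_nonneg (show 0 ≤ ((p : ℝ) ^ n) ^ (t + 2 - 2) by
      positivity)]
    simp only [Nat.add_sub_cancel, show t + 2 - 1 = t + 1 from rfl]
    refine (abs_sub_le _ (D * floorColength p d n) _).trans ?_
    rw [mul_assoc D y, ← mul_sub]
    linarith
  · have h := hy 1
    rw [pow_one] at h
    have e : D * y - D * (floorColength p d 1 / (p : ℝ) ^ (t + 1)) =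
        -(D / (p : ℝ) ^ (t + 1) * (floorColength p d 1 - y * (p : ℝ) ^ (t + 1))) := by
      field_simp
      ring
    rw [e, abs_neg, abs_mul, abs_of_pos (show 0 < D / (p : ℝ) ^ (t + 1) by positivity)]
    refine (mul_le_mul_of_nonneg_left h (by positivity)).trans_eq ?_
    rw [pow_succ]
    field_simp

end Multiplicity

/-- Subtracting the two expansions gives `(m - m') q ^ (t + 1) = O(q ^ t)` with `q = p ^ n`
unbounded. -/
theorem isHilbertKunzMultiplicity_unique {p t : ℕ} (hp : 1 < p)
    {f : MvPolynomial (Fin (t + 2)) (ZMod p)} {m m' : ℝ}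
    (h : IsHilbertKunzMultiplicity f m) (h' : IsHilbertKunzMultiplicity f m') : m = m' := by
  obtain ⟨-, e, he, hO⟩ := h
  obtain ⟨-, e', he', hO'⟩ := h'
  obtain rfl : e = e' := funext fun n => by
    have := (he n).symm.trans (he' n)
    exact_mod_cast this
  have hp' : (1 : ℝ) < p := by exact_mod_cast hp
  have key := hO'.sub hO
  obtain ⟨C, hC⟩ := key.bound
  have hlim : Tendsto (fun n : ℕ => C * ((p : ℝ)⁻¹) ^ n) atTop (𝓝 (C * 0)) :=
    (tendsto_pow_atTop_nhds_zero_of_lt_one (by positivity) (inv_lt_one_of_one_lt₀ hp')).const_mul C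
  rw [mul_zero] at hlim
  have hle : |m - m'| ≤ 0 := by
    refine ge_of_tendsto hlim ?_
    filter_upwards [hC] with n hn
    have hq : (0 : ℝ) < (p : ℝ) ^ n := by positivity
    simp only [Nat.add_sub_cancel, show t + 2 - 1 = t + 1 from rfl] at hn
    rw [show (e n : ℝ) - m' * ((p : ℝ) ^ n) ^ (t + 1) - (e n - m * ((p : ℝ) ^ n) ^ (t + 1)) =
      (m - m') * ((p : ℝ) ^ n) ^ (t + 1) by ring, norm_mul, Real.norm_eq_abs, Real.norm_eq_abs,
      Real.norm_eq_abs, abs_of_pos (show (0 : ℝ) < ((p : ℝ) ^ n) ^ (t + 1) by positivity),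
      abs_of_pos (show (0 : ℝ) < ((p : ℝ) ^ n) ^ t by positivity), pow_succ] at hn
    have hqt : (0 : ℝ) < ((p : ℝ) ^ n) ^ t := by positivity
    rw [inv_pow, ← div_eq_mul_inv, le_div_iff₀ hq]
    refine le_of_mul_le_mul_right ?_ hqt
    linarith
  exact sub_eq_zero.1 (abs_eq_zero.1 (le_antisymm hle (abs_nonneg _)))

end DiagonalHK

theorem theorem2p4 (s : ℕ) (hs : 2 ≤ s) (d : Fin s → ℕ) (hd : ∀ i, 1 < d i) :
    (∀ p : ℕ, p.Prime → ∃! m : ℝ, IsHilbertKunzMultiplicity (diagonalForm p d) m) ∧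
    (Function.support (signSum d)).Finite ∧
    (∀ μ : ℕ → ℝ,
      (∀ p : ℕ, p.Prime → IsHilbertKunzMultiplicity (diagonalForm p d) (μ p)) →
      Filter.Tendsto μ (Filter.atTop ⊓ Filter.principal {p : ℕ | p.Prime})
        (nhds ((((∏ i, d i : ℕ) : ℝ) * (2 : ℝ) ^ (1 - (s : ℤ)) / ((s - 1).factorial : ℝ)) *
          ∑ᶠ l : ℤ, signSum d l))) ∧
    (((∏ i, d i : ℕ) : ℝ) * (2 : ℝ) ^ (1 - (s : ℤ)) / ((s - 1).factorial : ℝ)) *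
        ∑ᶠ l : ℤ, signSum d l =
      (((∏ i, d i : ℕ) : ℝ) * (2 : ℝ) ^ (1 - (s : ℤ)) / ((s - 1).factorial : ℝ)) *
        (signSum d 0 + 2 * ∑ᶠ (l : ℤ) (_ : 0 < l), signSum d l) := by
  obtain ⟨t, rfl⟩ : ∃ t, s = t + 2 := ⟨s - 2, by omega⟩
  have hd0 : ∀ i, 0 < d i := fun i => zero_lt_one.trans (hd i)
  refine ⟨fun p hp => ?_, ?_, fun μ hμ => ?_, ?_⟩
  · have : Fact p.Prime := ⟨hp⟩
    obtain ⟨m, hm, -⟩ := DiagonalHK.exists_isHilbertKunzMultiplicity p hd0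
    exact ⟨m, hm, fun m' hm' => DiagonalHK.isHilbertKunzMultiplicity_unique hp.one_lt hm' hm⟩
  · exact (Finset.finite_toSet _).subset
      (DiagonalHK.support_signSum_subset (Nat.succ_pos t) d hd0)
  -- Uniqueness identifies `μ p` with the constructed multiplicity, which is within `O(1 / p)` of
  -- the normalized middle count, so both have the same limit.
  · have hbound : ∀ p : ℕ, p.Prime →
        dist (μ p) ((∏ i, d i : ℕ) *
          ((DiagonalHK.middleCount p (fun i => p / d i) : ℝ) / (p : ℝ) ^ (t + 1))) ≤
        (∏ i, d i : ℕ) * (2 * (t + 2)) / p := fun p hp => by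
      have : Fact p.Prime := ⟨hp⟩
      obtain ⟨m, hm, hm'⟩ := DiagonalHK.exists_isHilbertKunzMultiplicity p hd0
      rw [DiagonalHK.isHilbertKunzMultiplicity_unique hp.one_lt (hμ p hp) hm,
        ← DiagonalHK.linColength_eq_middleCount (k := ZMod p) p _
          fun i => Nat.div_le_self p (d i), Real.dist_eq]
      simpa [DiagonalHK.floorColength] using hm'
    have hlim := (DiagonalHK.tendsto_middleCount (Nat.succ_pos t) d hd0).const_mul
      ((∏ i, d i : ℕ) : ℝ)
    have hzero : Filter.Tendsto (fun p : ℕ => ((∏ i, d i : ℕ) : ℝ) * (2 * (t + 2)) / (p : ℝ))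
        Filter.atTop (nhds 0) := tendsto_const_div_atTop_nhds_zero_nat _
    have hval : (((∏ i, d i : ℕ) : ℝ) * (2 : ℝ) ^ (1 - ((t + 2 : ℕ) : ℤ)) /
        ((t + 2 - 1).factorial : ℝ)) * ∑ᶠ l : ℤ, signSum d l = ((∏ i, d i : ℕ) : ℝ) *
          ((2 : ℝ) ^ (1 - ((t + 1 + 1 : ℕ) : ℤ)) / (t + 1).factorial * ∑ᶠ l : ℤ, signSum d l) := by
      rw [show t + 2 - 1 = t + 1 from rfl]
      ring
    rw [hval]
    refine (hlim.mono_left inf_le_left).congr_dist ?_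
    refine squeeze_zero' (Filter.Eventually.of_forall fun _ => dist_nonneg) ?_
      (hzero.mono_left inf_le_left)
    filter_upwards [Filter.mem_inf_of_right (Filter.mem_principal_self {p : ℕ | p.Prime})] with p hp
    rw [dist_comm]
    exact hbound p hp
  · rw [DiagonalHK.finsum_signSum_eq (Nat.succ_pos t) d hd0]
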